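/- Notation. $(a)_n=a(a+1)\cdots(a+n-1)$ is the shifted factorial. ${}_4F_3(a_1,a_2,a_3,a_4;b_1,b_2,b_3;w)$ is the sum of $\sum_{n\ge0}\frac{(a_1)_n(a_2)_n(a_3)_n(a_4)_n}{(b_1)_n(b_2)_n(b_3)_n\,n!}w^n$ for $|w|<1$, continued holomorphically to $w\in\mathbb{C}\setminus[1,\infty)$; ${}_2F_1$ is the Gauss hypergeometric function (used below only at arguments in $(0,1)$). Appell's function $F_3(\alpha_1,\alpha_2;\beta_1,\beta_2;\gamma;z_1,z_2)$ is the sum of $$\sum_{k,l\ge0}\frac{(\alpha_1)_k(\alpha_2)_l(\beta_1)_k(\beta_2)_l}{(\gamma)_{k+l}}\frac{z_1^k}{k!}\frac{z_2^l}{l!}$$ for $|z_1|,|z_2|<1$, continued holomorphically to $(z_1,z_2)\in(\mathbb{C}\setminus[1,\infty))^2$. Powers have their principal values. Statement. Let $\sigma,a_1,a_2,a_3,b_1,b_2,b_3\in\mathbb{C}$ with $\operatorname{Re}b_k>\operatorname{Re}a_k>0$ for $k=1,2,3$, and put $S=b_1+b_2+b_3-a_1-a_2-a_3$. Then the holomorphic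 continuations of ${}_4F_3(\sigma,a_1,a_2,a_3;b_1,b_2,b_3;\cdot)$ and of $F_3(b_2-a_3,b_3-a_1;b_2-a_2,b_1-a_1;S;\cdot,\cdot)$ to the indicated domains exist, and for every $z\in\mathbb{C}\setminus(-\infty,-1]$ (that is, $|\arg(1+z)|<\pi$) both of the following integrals converge absolutely and $${}_4F_3(\sigma,a_1,a_2,a_3;b_1,b_2,b_3;-z)=\frac{\Gamma(b_1)\Gamma(b_2)\Gamma(b_3)}{\Gamma(a_1)\Gamma(a_2)\Gamma(a_3)\Gamma(b_2-a_2)\Gamma(b_1+b_3-a_1-a_3)}$$ $$\times\iint_{[0,1]^2}\frac{s^{a_2-1}y^{b_1+b_3-a_1-a_3-1}(1-s)^{S-1}(1-y)^{b_2-a_2-1}}{(1+sz)^{\sigma}(1-y(1-s))^{b_2-a_3}}\;{}_2F_1\bigl(b_3-a_1,b_1-a_1;b_1+b_3-a_1-a_3;y(1-s)\bigr)\,ds\,dy,$$ $${}_4F_3(\sigma,a_1,a_2,a_3;b_1,b_2,b_3;-z)=\frac{\Gamma(b_1)\Gamma(b_2)\Gamma(b_3)}{\Gamma(a_1)\Gamma(a_2)\Gamma(a_3)\Gamma(S)}$$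 $$\times\int_0^1\frac{s^{a_2+a_3-b_2-1}(1-s)^{S-1}}{(1+sz)^{\sigma}}\;F_3\Bigl(b_2-a_3,b_3-a_1;b_2-a_2,b_1-a_1;S;1-\tfrac1s,1-s\Bigr)\,ds.$$ -/

import Mathlib

open MeasureTheory Complex
open scoped Nat

noncomputable section

/-- The shifted factorial `(a)_n = a (a + 1) ⋯ (a + n - 1)`. -/
def shiftedFactorial (a : ℂ) (n : ℕ) : ℂ := (ascPochhammer ℂ n).eval a

/-- `F` is a holomorphic continuation to `U` of the function `f`, given on the unit ball
(in `ℂ × ℂ`, whose norm is the sup norm, this is the unit bidisc). -/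
def IsHolomorphicContinuation {E : Type*} [NormedAddCommGroup E] [NormedSpace ℂ E]
    (f : E → ℂ) (U : Set E) (F : E → ℂ) : Prop :=
  DifferentiableOn ℂ F U ∧ Set.EqOn F f (Metric.ball 0 1 ∩ U)

open Classical in
/-- The holomorphic continuation of `f` from the unit ball to `U` (and `0` if there is none). -/
def holomorphicContinuation {E : Type*} [NormedAddCommGroup E] [NormedSpace ℂ E]
    (f : E → ℂ) (U : Set E) : E → ℂ :=
  if h : ∃ F, IsHolomorphicContinuation f U F then h.choose else 0

/-- On an open set that is star-shaped about `0`, the continuation is unique, so that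
`holomorphicContinuation` does not depend on any choice there. -/
theorem IsHolomorphicContinuation.eqOn {E : Type*} [NormedAddCommGroup E] [NormedSpace ℂ E]
    {f : E → ℂ} {U : Set E} (hU : IsOpen U) (hs : StarConvex ℝ 0 U)
    {F G : E → ℂ} (hF : IsHolomorphicContinuation f U F)
    (hG : IsHolomorphicContinuation f U G) : Set.EqOn F G U := by
  intro p hp
  have h0 : (0 : E) ∈ U := hs.mem ⟨p, hp⟩
  let ℓ : ℂ → E := fun t => t • p
  have hℓ : Differentiable ℂ ℓ := differentiable_id.smul_const p
  let T : Set ℂ := ℓ ⁻¹' U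
  have hT : IsOpen T := hU.preimage hℓ.continuous
  have h0T : (0 : ℂ) ∈ T := by simpa [T, ℓ] using h0
  have hTs : StarConvex ℝ 0 T := by
    rw [starConvex_zero_iff]
    intro t ht a ha0 ha1
    have := (starConvex_zero_iff.mp hs) ht ha0 ha1
    simpa [T, ℓ, mul_smul] using this
  have hTc : IsPreconnected T :=
    (hTs.isPathConnected h0T).isConnected.isPreconnected
  have hFa : AnalyticOnNhd ℂ (F ∘ ℓ) T :=
    (hF.1.comp hℓ.differentiableOn (Set.mapsTo_preimage ℓ U)).analyticOnNhd hT
  have hGa : AnalyticOnNhd ℂ (G ∘ ℓ) T :=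
    (hG.1.comp hℓ.differentiableOn (Set.mapsTo_preimage ℓ U)).analyticOnNhd hT
  have hev : (F ∘ ℓ) =ᶠ[nhds 0] (G ∘ ℓ) := by
    have hb : ℓ ⁻¹' (Metric.ball 0 1 ∩ U) ∈ nhds (0 : ℂ) := by
      refine ((Metric.isOpen_ball.inter hU).preimage hℓ.continuous).mem_nhds ?_
      simpa [ℓ] using h0
    filter_upwards [hb] with t ht
    exact (hF.2 ht).trans (hG.2 ht).symm
  have h1 : (1 : ℂ) ∈ T := by simpa [T, ℓ] using hp
  simpa [ℓ] using hFa.eqOn_of_preconnected_of_eventuallyEq hGa hTc h0T hev h1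

/-- The generalized hypergeometric series
`∑ (a_1)_n ⋯ (a_{q+1})_n / ((b_1)_n ⋯ (b_q)_n n!) zⁿ`. -/
def hypergeometricSeries {q : ℕ} (a : Fin (q + 1) → ℂ) (b : Fin q → ℂ) (z : ℂ) : ℂ :=
  ∑' n : ℕ, (∏ i, shiftedFactorial (a i) n) / ((∏ j, shiftedFactorial (b j) n) * (n ! : ℂ)) * z ^ n

/-- The complex plane cut along the ray `[1, ∞)` of the real axis. -/
def cutPlane : Set ℂ := {z | 1 - z ∈ slitPlane}

/-- The generalized hypergeometric function `_{q+1}F_q`: the sum of the hypergeometric series,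
continued holomorphically to the plane cut along `[1, ∞)`. -/
def hypergeometricFun {q : ℕ} (a : Fin (q + 1) → ℂ) (b : Fin q → ℂ) : ℂ → ℂ :=
  holomorphicContinuation (hypergeometricSeries a b) cutPlane

/-- Appell's double series `F₃(α₁, α₂; β₁, β₂; γ; z₁, z₂)`. -/
def appellF3Series (α₁ α₂ β₁ β₂ γ : ℂ) (z : ℂ × ℂ) : ℂ :=
  ∑' k : ℕ × ℕ,
    shiftedFactorial α₁ k.1 * shiftedFactorial α₂ k.2 *
        shiftedFactorial β₁ k.1 * shiftedFactorial β₂ k.2 / shiftedFactorial γ (k.1 + k.2) *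
      (z.1 ^ k.1 / (k.1 ! : ℂ)) * (z.2 ^ k.2 / (k.2 ! : ℂ))

/-- Appell's function `F₃(α₁, α₂; β₁, β₂; γ; z₁, z₂)`: the sum of the double series, continued
holomorphically to the product of two planes cut along `[1, ∞)`. -/
def appellF3 (α₁ α₂ β₁ β₂ γ z₁ z₂ : ℂ) : ℂ :=
  holomorphicContinuation (appellF3Series α₁ α₂ β₁ β₂ γ) (cutPlane ×ˢ cutPlane) (z₁, z₂)

/-- The integrand of the double integral, a function of `(s, y)`. -/
def doubleIntegrand (σ a₁ a₂ a₃ b₁ b₂ b₃ z : ℂ) (p : ℝ × ℝ) : ℂ :=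
  (p.1 : ℂ) ^ (a₂ - 1) * (p.2 : ℂ) ^ (b₁ + b₃ - a₁ - a₃ - 1) *
      (1 - p.1 : ℂ) ^ (b₁ + b₂ + b₃ - a₁ - a₂ - a₃ - 1) * (1 - p.2 : ℂ) ^ (b₂ - a₂ - 1) /
    ((1 + p.1 * z) ^ σ * (1 - p.2 * (1 - p.1) : ℂ) ^ (b₂ - a₃)) *
  ₂F₁ (b₃ - a₁) (b₁ - a₁) (b₁ + b₃ - a₁ - a₃) (p.2 * (1 - p.1) : ℂ)

/-- The integrand of the single integral. -/
def singleIntegrand (σ a₁ a₂ a₃ b₁ b₂ b₃ z : ℂ) (s : ℝ) : ℂ :=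
  (s : ℂ) ^ (a₂ + a₃ - b₂ - 1) * (1 - s : ℂ) ^ (b₁ + b₂ + b₃ - a₁ - a₂ - a₃ - 1) /
    (1 + s * z) ^ σ *
  appellF3 (b₂ - a₃) (b₃ - a₁) (b₂ - a₂) (b₁ - a₁) (b₁ + b₂ + b₃ - a₁ - a₂ - a₃)
    (1 - 1 / s) (1 - s)

end

noncomputable section

/-! For `Re b > Re a > 0` the ratio `(a)_n / (b)_n` is the `n`-th moment of the normalized beta
density `t ^ (a - 1) * (1 - t) ^ (b - a - 1)` on `(0, 1)`. The densities are complex-valued, but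
they multiply like laws of independent variables `X₁, X₂, X₃`. Hence the moments of `X₁ X₂ X₃` are
the products of these ratios, and the binomial series gives `₄F₃(z) = E[(1 - X₁ X₂ X₃ z) ^ (-σ)]`
for `|z| < 1`. For `t ∈ [0, 1]` and `z` in the cut plane, `1 - t z` stays in the slit plane, so the
expectation is holomorphic on the whole cut plane and is the continuation.

The double integral is this expectation in other coordinates. `squareMap` sends two factors `(q, t)`
to their product `s = q t` and to `y` with `y (1 - s) = 1 - q`. Applied to `X₁, X₃` and combined
with Euler's integral, it yields the density `mulBetaKernel` of `X₁ X₃`, where `₂F₁` has argument `1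
- p`; applied to `X₁ X₃` and `X₂`, it yields the double integrand (`doubleIntegrand_squareMap`).

Integration over `y` produces `F₃`: its Dirichlet-type integral
(`isHolomorphicContinuation_appellF3Series`), with one variable removed by Euler's integral, matches
at `(1 - 1/s, 1 - s)` because `1 - (1 - y) (1 - 1/s) = (1 - y (1 - s)) / s`. Absolute convergence is
inherited throughout from products of beta kernels, by change of variables and Fubini. -/

/-! ### The cut plane and holomorphic continuation. -/

theorem one_sub_ofReal_mul_mem_slitPlane {z : ℂ} (hz : z ∈ cutPlane) {t : ℝ}
    (ht : t ∈ Set.Icc (0 : ℝ) 1) : 1 - t * z ∈ slitPlane := by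
  have h : (1 : ℂ) + -z ∈ slitPlane := by simpa [cutPlane, sub_eq_add_neg] using hz
  simpa [sub_eq_add_neg] using starConvex_one_slitPlane.add_smul_mem h ht.1 ht.2

theorem isOpen_cutPlane : IsOpen cutPlane :=
  isOpen_slitPlane.preimage (by fun_prop : Continuous fun z : ℂ => 1 - z)

theorem starConvex_cutPlane : StarConvex ℝ 0 cutPlane := by
  rw [starConvex_zero_iff]
  intro z hz a h0 h1
  simpa [cutPlane] using one_sub_ofReal_mul_mem_slitPlane hz ⟨h0, h1⟩

theorem mem_cutPlane_of_norm_lt_one {z : ℂ} (hz : ‖z‖ < 1) : z ∈ cutPlane := by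
  have := mem_slitPlane_of_norm_lt_one (z := -z) (by simpa using hz)
  simpa [cutPlane, sub_eq_add_neg] using this

theorem IsHolomorphicContinuation.holomorphicContinuation {E : Type*} [NormedAddCommGroup E]
    [NormedSpace ℂ E] {f : E → ℂ} {U : Set E} {F : E → ℂ} (hF : IsHolomorphicContinuation f U F) :
    IsHolomorphicContinuation f U (holomorphicContinuation f U) := by
  have h : ∃ F, IsHolomorphicContinuation f U F := ⟨F, hF⟩
  rw [_root_.holomorphicContinuation, dif_pos h]
  exact h.choose_spec

theorem IsHolomorphicContinuation.holomorphicContinuation_apply {E : Type*} [NormedAddCommGroup E]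
    [NormedSpace ℂ E] {f : E → ℂ} {U : Set E} (hU : IsOpen U) (hs : StarConvex ℝ 0 U)
    {F : E → ℂ} (hF : IsHolomorphicContinuation f U F) {z : E} (hz : z ∈ U) :
    _root_.holomorphicContinuation f U z = F z :=
  hF.holomorphicContinuation.eqOn hU hs hF hz

/-! ### The binomial series. -/

theorem HasSum.of_eq {ι : Type*} {f g : ι → ℂ} {a : ℂ} (h : HasSum f a) (e : ∀ i, g i = f i) :
    HasSum g a := by
  rwa [funext e]

theorem hasSum_one_sub_cpow_neg (α : ℂ) {w : ℂ} (hw : ‖w‖ < 1) :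
    HasSum (fun n : ℕ => shiftedFactorial α n / n ! * w ^ n) ((1 - w) ^ (-α)) := by
  have h := (one_div_one_sub_cpow_hasFPowerSeriesOnBall_zero α).hasSum (y := w)
    (by rw [Metric.mem_eball, edist_zero_right, ← ofReal_norm]; exact ENNReal.ofReal_lt_one.2 hw)
  simp only [zero_add, FormalMultilinearSeries.ofScalars_apply_eq, smul_eq_mul, one_div,
    ← cpow_neg] at h
  refine h.of_eq fun n => ?_
  rw [← Ring.multichoose_eq, shiftedFactorial, ← Polynomial.ascPochhammer_smeval_eq_eval,
    ← Ring.factorial_nsmul_multichoose_eq_ascPochhammer, nsmul_eq_mul,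
    mul_div_cancel_left₀ _ (by exact_mod_cast n.factorial_ne_zero)]

theorem summable_norm_one_sub_cpow_neg (α : ℂ) {w : ℂ} (hw : ‖w‖ < 1) :
    Summable fun n : ℕ => ‖shiftedFactorial α n / n ! * w ^ n‖ := 
  (hasSum_one_sub_cpow_neg α hw).summable.norm

/-! ### Shifted factorials, beta integrals and their moments. -/

theorem shiftedFactorial_eq_Gamma_div {a : ℂ} (ha : 0 < a.re) (n : ℕ) :
    shiftedFactorial a n = Gamma (a + n) / Gamma a := by
  rw [shiftedFactorial, Gamma_add_nat_div_Gamma_eq]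
  rintro k rfl
  simp at ha
  linarith [Nat.cast_nonneg (α := ℝ) k]

theorem shiftedFactorial_ne_zero {a : ℂ} (ha : 0 < a.re) (n : ℕ) :
    shiftedFactorial a n ≠ 0 := by
  rw [shiftedFactorial_eq_Gamma_div ha]
  refine div_ne_zero (Gamma_ne_zero_of_re_pos ?_) (Gamma_ne_zero_of_re_pos ha)
  simp
  positivity

/-- The density `t ^ (a - 1) * (1 - t) ^ (b - 1)` of the beta integral. -/
def betaKernel (a b : ℂ) (t : ℝ) : ℂ := (t : ℂ) ^ (a - 1) * (1 - t : ℂ) ^ (b - 1)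

theorem integrableOn_betaKernel {a b : ℂ} (ha : 0 < a.re) (hb : 0 < b.re) :
    IntegrableOn (betaKernel a b) (Set.Ioo 0 1) := by
  have h := betaIntegral_convergent ha hb
  rw [intervalIntegrable_iff_integrableOn_Ioo_of_le zero_le_one] at h
  exact h

theorem integral_betaKernel {a b : ℂ} (ha : 0 < a.re) (hb : 0 < b.re) :
    ∫ t in Set.Ioo 0 1, betaKernel a b t = Gamma a * Gamma b / Gamma (a + b) := by
  rw [← betaIntegral_eq_Gamma_mul_div a b ha hb, betaIntegral,
    intervalIntegral.integral_of_le zero_le_one, integral_Ioc_eq_integral_Ioo]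
  rfl

theorem betaKernel_mul_pow (a b : ℂ) (k l : ℕ) {t : ℝ} (ht : t ∈ Set.Ioo (0 : ℝ) 1) :
    betaKernel a b t * ((t : ℂ) ^ k * (1 - t : ℂ) ^ l) = betaKernel (a + k) (b + l) t := by
  have h0 : (t : ℂ) ≠ 0 := by exact_mod_cast ht.1.ne'
  have h1 : (1 - t : ℂ) ≠ 0 := by exact_mod_cast (sub_pos.2 ht.2).ne'
  simp only [betaKernel]
  rw [add_sub_right_comm, cpow_add _ _ h0, cpow_natCast, add_sub_right_comm b, cpow_add _ _ h1,
    cpow_natCast]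
  ring

theorem integral_betaKernel_mul_pow {a b : ℂ} (ha : 0 < a.re) (hb : 0 < b.re) (k l : ℕ) :
    ∫ t in Set.Ioo 0 1, betaKernel a b t * ((t : ℂ) ^ k * (1 - t : ℂ) ^ l) =
      Gamma a * Gamma b / Gamma (a + b) *
        (shiftedFactorial a k * shiftedFactorial b l / shiftedFactorial (a + b) (k + l)) := by
  rw [setIntegral_congr_fun measurableSet_Ioo fun t ht => betaKernel_mul_pow a b k l ht,
    integral_betaKernel (by simp; positivity) (by simp; positivity),
    shiftedFactorial_eq_Gamma_div ha, shiftedFactorial_eq_Gamma_div hb,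
    shiftedFactorial_eq_Gamma_div (by simp; positivity)]
  have hA := Gamma_ne_zero_of_re_pos ha
  have hB := Gamma_ne_zero_of_re_pos hb
  have hC : Gamma (a + b) ≠ 0 := Gamma_ne_zero_of_re_pos (by simp; positivity)
  have : a + k + (b + l) = a + b + ((k + l : ℕ) : ℂ) := by push_cast; ring
  rw [this]
  field_simp

/-! ### Termwise integration of power series. -/

/-- The integrals of the norms of the terms are at most `‖c i‖ * ∫ ‖g‖`, which is summable. This
serves single series on the interval and double series on the square alike. -/
theorem hasSum_integral_mul_tsum {X ι : Type*} [MeasurableSpace X] [Countable ι] {μ : Measure X}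
    {g : X → ℂ} (hg : Integrable g μ) {c : ι → ℂ} (hc : Summable fun i => ‖c i‖)
    {v : ι → X → ℂ} (hv : ∀ i, AEStronglyMeasurable (v i) μ)
    (hv1 : ∀ i, ∀ᵐ x ∂μ, ‖v i x‖ ≤ 1) {F : X → ℂ}
    (hF : ∀ᵐ x ∂μ, HasSum (fun i => c i * v i x) (F x)) :
    HasSum (fun i => c i * ∫ x, g x * v i x ∂μ) (∫ x, g x * F x ∂μ) := by
  have h1 : ∀ i, Integrable (fun x => g x * v i x) μ := fun i => hg.mul_bdd (hv i) (hv1 i)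
  have h2 : Summable fun i => ∫ x, ‖c i * (g x * v i x)‖ ∂μ := by
    refine (hc.mul_right (∫ x, ‖g x‖ ∂μ)).of_nonneg_of_le
      (fun i => integral_nonneg fun x => norm_nonneg _) fun i => ?_
    simp only [norm_mul (c i), integral_const_mul]
    refine mul_le_mul_of_nonneg_left (integral_mono_ae ?_ ?_ ?_) (norm_nonneg _)
    · simpa only [norm_mul] using (h1 i).norm
    · exact hg.norm
    · filter_upwards [hv1 i] with x hx
      simpa using mul_le_mul_of_nonneg_left hx (norm_nonneg (g x))
  have h := hasSum_integral_of_summable_integral_norm (fun i => (h1 i).const_mul (c i)) h2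
  simp only [integral_const_mul] at h
  have e : ∫ x, g x * F x ∂μ = ∫ x, ∑' i, c i * (g x * v i x) ∂μ := by
    refine integral_congr_ae ?_
    filter_upwards [hF] with x hx
    rw [← (hx.mul_left (g x)).tsum_eq]
    exact tsum_congr fun i => by ring
  rw [e]
  exact h

theorem hasSum_mul_complex {f g : ℕ → ℂ} {a b : ℂ} (hf : HasSum f a) (hg : HasSum g b) :
    HasSum (fun k : ℕ × ℕ => f k.1 * g k.2) (a * b) :=
  HasSum.mul hf hg (summable_mul_of_summable_norm hf.summable.norm hg.summable.norm)

theorem hasSum_integral_mul_prod {X : Type*} [MeasurableSpace X] {μ : Measure X}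
    {g : X → ℂ} (hg : Integrable g μ) {u₁ u₂ : X → ℝ} (hu₁ : AEStronglyMeasurable u₁ μ)
    (hu₂ : AEStronglyMeasurable u₂ μ) (h₁ : ∀ᵐ x ∂μ, u₁ x ∈ Set.Icc (0 : ℝ) 1)
    (h₂ : ∀ᵐ x ∂μ, u₂ x ∈ Set.Icc (0 : ℝ) 1) {c₁ c₂ : ℕ → ℂ} (hc₁ : Summable fun n => ‖c₁ n‖)
    (hc₂ : Summable fun n => ‖c₂ n‖) {F₁ F₂ : ℝ → ℂ}
    (hF₁ : ∀ t ∈ Set.Icc (0 : ℝ) 1, HasSum (fun n => c₁ n * (t : ℂ) ^ n) (F₁ t))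
    (hF₂ : ∀ t ∈ Set.Icc (0 : ℝ) 1, HasSum (fun n => c₂ n * (t : ℂ) ^ n) (F₂ t)) :
    HasSum (fun k : ℕ × ℕ => c₁ k.1 * c₂ k.2 *
        ∫ x, g x * ((u₁ x : ℂ) ^ k.1 * (u₂ x : ℂ) ^ k.2) ∂μ)
      (∫ x, g x * (F₁ (u₁ x) * F₂ (u₂ x)) ∂μ) := by
  refine hasSum_integral_mul_tsum (c := fun k : ℕ × ℕ => c₁ k.1 * c₂ k.2)
    (v := fun k x => (u₁ x : ℂ) ^ k.1 * (u₂ x : ℂ) ^ k.2) hg (hc₁.mul_norm hc₂)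
    (fun n => ?_) (fun n => ?_) ?_
  · exact ((continuous_ofReal.comp_aestronglyMeasurable hu₁).pow n.1).mul
      ((continuous_ofReal.comp_aestronglyMeasurable hu₂).pow n.2)
  · filter_upwards [h₁, h₂] with x hx hx'
    rw [norm_mul, norm_pow, norm_pow, norm_real, norm_real, Real.norm_of_nonneg hx.1,
      Real.norm_of_nonneg hx'.1]
    exact mul_le_one₀ (pow_le_one₀ hx.1 hx.2) (pow_nonneg hx'.1 _) (pow_le_one₀ hx'.1 hx'.2)
  · filter_upwards [h₁, h₂] with x hx hx'
    have e₁ := hF₁ _ hx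
    have e₂ := hF₂ _ hx'
    have h := hasSum_mul_complex e₁ e₂
    have e : ∀ k : ℕ × ℕ, c₁ k.1 * c₂ k.2 * ((u₁ x : ℂ) ^ k.1 * (u₂ x : ℂ) ^ k.2) =
        c₁ k.1 * (u₁ x : ℂ) ^ k.1 * (c₂ k.2 * (u₂ x : ℂ) ^ k.2) := fun k => by ring
    exact h.of_eq e

theorem hasSum_one_sub_ofReal_mul_cpow_neg (α : ℂ) {z : ℂ} (hz : ‖z‖ < 1) {t : ℝ}
    (ht : t ∈ Set.Icc (0 : ℝ) 1) :
    HasSum (fun n : ℕ => shiftedFactorial α n / n ! * z ^ n * (t : ℂ) ^ n)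
      ((1 - t * z) ^ (-α)) := by
  have h : ‖t * z‖ < 1 := by
    rw [norm_mul, norm_real, Real.norm_of_nonneg ht.1]
    exact (mul_le_of_le_one_left (norm_nonneg z) ht.2).trans_lt hz
  refine (hasSum_one_sub_cpow_neg α h).of_eq fun n => ?_
  ring

theorem hasSum_integral_mul_one_sub_cpow {X : Type*} [MeasurableSpace X] {μ : Measure X}
    {g : X → ℂ} (hg : Integrable g μ) {u : X → ℝ} (hu : AEStronglyMeasurable u μ)
    (hu1 : ∀ᵐ x ∂μ, u x ∈ Set.Icc (0 : ℝ) 1) (α : ℂ) {z : ℂ} (hz : ‖z‖ < 1) :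
    HasSum (fun n : ℕ => shiftedFactorial α n / n ! * z ^ n * ∫ x, g x * (u x : ℂ) ^ n ∂μ)
      (∫ x, g x * (1 - u x * z) ^ (-α) ∂μ) := by
  refine hasSum_integral_mul_tsum hg (summable_norm_one_sub_cpow_neg α hz)
    (fun n => (continuous_ofReal.comp_aestronglyMeasurable hu).pow n) (fun n => ?_) ?_
  · filter_upwards [hu1] with x hx
    simpa [abs_of_nonneg hx.1] using pow_le_one₀ hx.1 hx.2
  · filter_upwards [hu1] with x hx
    exact hasSum_one_sub_ofReal_mul_cpow_neg α hz hx

theorem hasSum_integral_mul_one_sub_cpow_mul {X : Type*} [MeasurableSpace X] {μ : Measure X}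
    {g : X → ℂ} (hg : Integrable g μ) {u₁ u₂ : X → ℝ} (hu₁ : AEStronglyMeasurable u₁ μ)
    (hu₂ : AEStronglyMeasurable u₂ μ) (h₁ : ∀ᵐ x ∂μ, u₁ x ∈ Set.Icc (0 : ℝ) 1)
    (h₂ : ∀ᵐ x ∂μ, u₂ x ∈ Set.Icc (0 : ℝ) 1) (α₁ α₂ : ℂ) {z₁ z₂ : ℂ} (hz₁ : ‖z₁‖ < 1)
    (hz₂ : ‖z₂‖ < 1) :
    HasSum (fun k : ℕ × ℕ => shiftedFactorial α₁ k.1 / (k.1)! * z₁ ^ k.1 *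
        (shiftedFactorial α₂ k.2 / (k.2)! * z₂ ^ k.2) *
        ∫ x, g x * ((u₁ x : ℂ) ^ k.1 * (u₂ x : ℂ) ^ k.2) ∂μ)
      (∫ x, g x * ((1 - u₁ x * z₁) ^ (-α₁) * (1 - u₂ x * z₂) ^ (-α₂)) ∂μ) :=
  hasSum_integral_mul_prod (F₁ := fun t => (1 - t * z₁) ^ (-α₁))
    (F₂ := fun t => (1 - t * z₂) ^ (-α₂)) hg hu₁ hu₂ h₁ h₂
    (summable_norm_one_sub_cpow_neg α₁ hz₁) (summable_norm_one_sub_cpow_neg α₂ hz₂)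
    (fun _ ht => hasSum_one_sub_ofReal_mul_cpow_neg α₁ hz₁ ht)
    (fun _ ht => hasSum_one_sub_ofReal_mul_cpow_neg α₂ hz₂ ht)

/-! ### Holomorphic dependence on the parameters. -/

/-- The power is jointly continuous on the compact product of a closed ball inside the cut plane and
`[0, 1]`, hence bounded there. These local bounds dominate the integrands and their derivatives. -/
theorem exists_norm_one_sub_cpow_le (β : ℂ) {z₀ : ℂ} (hz₀ : z₀ ∈ cutPlane) :
    ∃ ε > 0, ∃ C, 0 ≤ C ∧ ∀ z ∈ Metric.ball z₀ ε, z ∈ cutPlane ∧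
      ∀ t ∈ Set.Icc (0 : ℝ) 1, ‖(1 - t * z) ^ β‖ ≤ C := by
  obtain ⟨ε, hε, h⟩ := Metric.nhds_basis_closedBall.mem_iff.1 (isOpen_cutPlane.mem_nhds hz₀)
  have hc : ContinuousOn (fun p : ℂ × ℝ => (1 - p.2 * p.1) ^ β)
      (Metric.closedBall z₀ ε ×ˢ Set.Icc (0 : ℝ) 1) := by
    refine ContinuousOn.cpow_const (by fun_prop) ?_
    rintro ⟨z, t⟩ ⟨hz, ht⟩
    exact one_sub_ofReal_mul_mem_slitPlane (h hz) ht
  obtain ⟨C, hC⟩ := ((isCompact_closedBall z₀ ε).prod isCompact_Icc).exists_bound_of_continuousOn hc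
  refine ⟨ε, hε, max C 0, le_max_right _ _, fun z hz => ⟨h (Metric.ball_subset_closedBall hz), ?_⟩⟩
  exact fun t ht => (hC (z, t) ⟨Metric.ball_subset_closedBall hz, ht⟩).trans (le_max_left _ _)

theorem hasDerivAt_one_sub_mul_cpow_neg (α : ℂ) {z : ℂ} {t : ℝ} (h : 1 - t * z ∈ slitPlane) :
    HasDerivAt (fun z : ℂ => (1 - t * z) ^ (-α)) (α * t * (1 - t * z) ^ (-α - 1)) z := by
  have h1 : HasDerivAt (fun z : ℂ => 1 - t * z) (-t) z := by
    simpa using ((hasDerivAt_id z).const_mul (t : ℂ)).const_sub 1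
  convert h1.cpow_const (c := -α) h using 1
  ring

theorem aestronglyMeasurable_one_sub_mul_cpow {X : Type*} [MeasurableSpace X] {μ : Measure X}
    {u : X → ℝ} (hu : AEStronglyMeasurable u μ) (β z : ℂ) :
    AEStronglyMeasurable (fun x => (1 - u x * z) ^ β) μ := by
  have h : AEMeasurable u μ := hu.aemeasurable
  have : AEMeasurable (fun x => (1 - u x * z : ℂ)) μ := by fun_prop
  exact (this.pow_const β).aestronglyMeasurable

theorem integrable_mul_one_sub_cpow {X : Type*} [MeasurableSpace X] {μ : Measure X}
    {g : X → ℂ} (hg : Integrable g μ) {u : X → ℝ} (hu : AEStronglyMeasurable u μ)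
    (h₁ : ∀ᵐ x ∂μ, u x ∈ Set.Icc (0 : ℝ) 1) (β : ℂ) {z : ℂ} (hz : z ∈ cutPlane) :
    Integrable (fun x => g x * (1 - u x * z) ^ β) μ := by
  obtain ⟨ε, hε, C, -, h⟩ := exists_norm_one_sub_cpow_le β hz
  refine hg.mul_bdd (aestronglyMeasurable_one_sub_mul_cpow hu β z) (c := C) ?_
  filter_upwards [h₁] with x hx
  exact (h z (Metric.mem_ball_self hε)).2 _ hx

/-- Differentiation under the integral sign: near a given point the Fréchet derivative of the
integrand is at most a constant times `‖g‖`. -/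
theorem differentiableOn_integral_mul_one_sub_cpow_mul {X : Type*} [MeasurableSpace X]
    {μ : Measure X} {g : X → ℂ} (hg : Integrable g μ) {u₁ u₂ : X → ℝ}
    (hu₁ : AEStronglyMeasurable u₁ μ) (hu₂ : AEStronglyMeasurable u₂ μ)
    (h₁ : ∀ᵐ x ∂μ, u₁ x ∈ Set.Icc (0 : ℝ) 1) (h₂ : ∀ᵐ x ∂μ, u₂ x ∈ Set.Icc (0 : ℝ) 1)
    (α₁ α₂ : ℂ) :
    DifferentiableOn ℂ
      (fun w : ℂ × ℂ => ∫ x, g x * ((1 - u₁ x * w.1) ^ (-α₁) * (1 - u₂ x * w.2) ^ (-α₂)) ∂μ)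
      (cutPlane ×ˢ cutPlane) := by
  rintro ⟨z₁, z₂⟩ ⟨hz₁, hz₂⟩
  obtain ⟨ε₁, hε₁, A₁, hA₁, B₁⟩ := exists_norm_one_sub_cpow_le (-α₁) hz₁
  obtain ⟨ε₂, hε₂, A₂, hA₂, B₂⟩ := exists_norm_one_sub_cpow_le (-α₂) hz₂
  obtain ⟨δ₁, hδ₁, D₁, hD₁, E₁⟩ := exists_norm_one_sub_cpow_le (-α₁ - 1) hz₁
  obtain ⟨δ₂, hδ₂, D₂, hD₂, E₂⟩ := exists_norm_one_sub_cpow_le (-α₂ - 1) hz₂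
  let s : Set (ℂ × ℂ) := (Metric.ball z₁ ε₁ ∩ Metric.ball z₁ δ₁) ×ˢ
    (Metric.ball z₂ ε₂ ∩ Metric.ball z₂ δ₂)
  have hs : s ∈ nhds (z₁, z₂) := prod_mem_nhds
    (Filter.inter_mem (Metric.ball_mem_nhds _ hε₁) (Metric.ball_mem_nhds _ hδ₁))
    (Filter.inter_mem (Metric.ball_mem_nhds _ hε₂) (Metric.ball_mem_nhds _ hδ₂))
  let F' : ℂ × ℂ → X → (ℂ × ℂ →L[ℂ] ℂ) := fun w x =>
    (g x * ((1 - u₁ x * w.1) ^ (-α₁) * (α₂ * u₂ x * (1 - u₂ x * w.2) ^ (-α₂ - 1)))) •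
        ContinuousLinearMap.snd ℂ ℂ ℂ +
      (g x * (α₁ * u₁ x * (1 - u₁ x * w.1) ^ (-α₁ - 1) * (1 - u₂ x * w.2) ^ (-α₂))) •
        ContinuousLinearMap.fst ℂ ℂ ℂ
  have hu₁' : AEStronglyMeasurable (fun x => (u₁ x : ℂ)) μ :=
    continuous_ofReal.comp_aestronglyMeasurable hu₁
  have hu₂' : AEStronglyMeasurable (fun x => (u₂ x : ℂ)) μ :=
    continuous_ofReal.comp_aestronglyMeasurable hu₂
  have hmul : ∀ w : ℂ × ℂ, AEStronglyMeasurable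
      (fun x => g x * ((1 - u₁ x * w.1) ^ (-α₁) * (1 - u₂ x * w.2) ^ (-α₂))) μ := fun w =>
    hg.1.fun_mul ((aestronglyMeasurable_one_sub_mul_cpow hu₁ (-α₁) w.1).fun_mul
      (aestronglyMeasurable_one_sub_mul_cpow hu₂ (-α₂) w.2))
  have hm₁ : AEStronglyMeasurable (fun x => g x * (α₁ * u₁ x * (1 - u₁ x * z₁) ^ (-α₁ - 1) *
      (1 - u₂ x * z₂) ^ (-α₂))) μ := by
    have m₁ := aestronglyMeasurable_one_sub_mul_cpow hu₁ (-α₁ - 1) z₁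
    have m₂ := aestronglyMeasurable_one_sub_mul_cpow hu₂ (-α₂) z₂
    exact hg.1.fun_mul (((hu₁'.const_mul α₁).fun_mul m₁).fun_mul m₂)
  have hm₂ : AEStronglyMeasurable (fun x => g x * ((1 - u₁ x * z₁) ^ (-α₁) *
      (α₂ * u₂ x * (1 - u₂ x * z₂) ^ (-α₂ - 1)))) μ := by
    have m₁ := aestronglyMeasurable_one_sub_mul_cpow hu₁ (-α₁) z₁
    have m₂ := aestronglyMeasurable_one_sub_mul_cpow hu₂ (-α₂ - 1) z₂
    exact hg.1.fun_mul (m₁.fun_mul ((hu₂'.const_mul α₂).fun_mul m₂))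
  let F : ℂ × ℂ → X → ℂ := fun w x => g x * ((1 - u₁ x * w.1) ^ (-α₁) * (1 - u₂ x * w.2) ^ (-α₂))
  let K : ℝ := A₁ * (‖α₂‖ * D₂) + ‖α₁‖ * D₁ * A₂
  have hF_int : Integrable (F (z₁, z₂)) μ := by
    have h := integrable_mul_one_sub_cpow
      (integrable_mul_one_sub_cpow hg hu₁ h₁ (-α₁) hz₁) hu₂ h₂ (-α₂) hz₂
    exact h.congr (Filter.Eventually.of_forall fun x => mul_assoc _ _ _)
  have hF'_meas : AEStronglyMeasurable (F' (z₁, z₂)) μ :=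
    (hm₂.smul_const _).fun_add (hm₁.smul_const _)
  have hbound : ∀ᵐ x ∂μ, ∀ w ∈ s, ‖F' w x‖ ≤ ‖g x‖ * K := by
    filter_upwards [h₁, h₂] with x hx₁ hx₂
    rintro ⟨w₁, w₂⟩ ⟨⟨hw₁, hw₁'⟩, hw₂, hw₂'⟩
    have n₁ : ‖(u₁ x : ℂ)‖ ≤ 1 := by simpa [abs_of_nonneg hx₁.1] using hx₁.2
    have n₂ : ‖(u₂ x : ℂ)‖ ≤ 1 := by simpa [abs_of_nonneg hx₂.1] using hx₂.2
    have b₁ := (B₁ w₁ hw₁).2 _ hx₁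
    have b₂ := (B₂ w₂ hw₂).2 _ hx₂
    have e₁ := (E₁ w₁ hw₁').2 _ hx₁
    have e₂ := (E₂ w₂ hw₂').2 _ hx₂
    simp only [K, mul_add]
    refine (norm_add_le _ _).trans (add_le_add ?_ ?_)
    · rw [norm_smul]
      refine (mul_le_of_le_one_right (norm_nonneg _) (ContinuousLinearMap.norm_snd_le ℂ ℂ ℂ)).trans ?_
      simp only [norm_mul]
      have : ‖α₂‖ * ‖(u₂ x : ℂ)‖ ≤ ‖α₂‖ := mul_le_of_le_one_right (norm_nonneg _) n₂
      gcongr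
    · rw [norm_smul]
      refine (mul_le_of_le_one_right (norm_nonneg _) (ContinuousLinearMap.norm_fst_le ℂ ℂ ℂ)).trans ?_
      simp only [norm_mul]
      have : ‖α₁‖ * ‖(u₁ x : ℂ)‖ ≤ ‖α₁‖ := mul_le_of_le_one_right (norm_nonneg _) n₁
      gcongr
  have hbound_int : Integrable (fun x => ‖g x‖ * K) μ := hg.norm.mul_const K
  have hdiff : ∀ᵐ x ∂μ, ∀ w ∈ s, HasFDerivAt (fun w => F w x) (F' w x) w := by
    filter_upwards [h₁, h₂] with x hx₁ hx₂
    rintro ⟨w₁, w₂⟩ ⟨⟨hw₁, hw₁'⟩, hw₂, hw₂'⟩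
    have d₁ := (hasDerivAt_one_sub_mul_cpow_neg α₁ (one_sub_ofReal_mul_mem_slitPlane
      (B₁ w₁ hw₁).1 hx₁)).comp_hasFDerivAt (w₁, w₂) (hasFDerivAt_fst (𝕜 := ℂ) (p := (w₁, w₂)))
    have d₂ := (hasDerivAt_one_sub_mul_cpow_neg α₂ (one_sub_ofReal_mul_mem_slitPlane
      (B₂ w₂ hw₂).1 hx₂)).comp_hasFDerivAt (w₁, w₂) (hasFDerivAt_snd (𝕜 := ℂ) (p := (w₁, w₂)))
    refine ((d₁.mul d₂).const_mul (g x)).congr_fderiv ?_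
    -- Cancelling the common factor `g x` would turn the equation into a disjunction, out of reach
    -- of `ring`.
    ext <;> simp [F', -mul_eq_mul_left_iff] <;> ring
  have key : HasFDerivAt (fun w => ∫ x, F w x ∂μ) (∫ x, F' (z₁, z₂) x ∂μ) (z₁, z₂) :=
    hasFDerivAt_integral_of_dominated_of_fderiv_le hs
      (Filter.Eventually.of_forall hmul) hF_int hF'_meas hbound hbound_int hdiff
  exact key.differentiableAt.differentiableWithinAt

/-- The two-variable statement with second exponent `0` and second variable `0`. -/
theorem differentiableOn_integral_mul_one_sub_cpow {X : Type*} [MeasurableSpace X]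
    {μ : Measure X} {g : X → ℂ} (hg : Integrable g μ) {u : X → ℝ}
    (hu : AEStronglyMeasurable u μ) (h₁ : ∀ᵐ x ∂μ, u x ∈ Set.Icc (0 : ℝ) 1) (α : ℂ) :
    DifferentiableOn ℂ (fun z : ℂ => ∫ x, g x * (1 - u x * z) ^ (-α) ∂μ) cutPlane := by
  have h := (differentiableOn_integral_mul_one_sub_cpow_mul hg hu hu h₁ h₁ α 0).comp
    (f := fun z : ℂ => (z, (0 : ℂ))) (s := cutPlane) (by fun_prop)
    fun z hz => ⟨hz, mem_cutPlane_of_norm_lt_one (by simp)⟩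
  simpa [Function.comp_def] using h

/-! ### Change of variables on the open unit square. -/

/-- The change of variables `(q, t) ↦ (q t, (1 - q) / (1 - q t))` of the open unit square. -/
def squareMap (p : ℝ × ℝ) : ℝ × ℝ := (p.1 * p.2, (1 - p.1) / (1 - p.1 * p.2))

/-- The derivative of `squareMap`. -/
def squareMapDeriv (p : ℝ × ℝ) : ℝ × ℝ →L[ℝ] ℝ × ℝ :=
  (Matrix.toLin (.finTwoProd ℝ) (.finTwoProd ℝ)
    !![p.2, p.1; -(1 - p.2) / (1 - p.1 * p.2) ^ 2,
      (1 - p.1) * p.1 / (1 - p.1 * p.2) ^ 2]).toContinuousLinearMap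

theorem one_sub_mul_pos {p : ℝ × ℝ} (hp : p ∈ Set.Ioo (0 : ℝ) 1 ×ˢ Set.Ioo (0 : ℝ) 1) :
    0 < 1 - p.1 * p.2 := by
  obtain ⟨⟨h1, h2⟩, h3, h4⟩ := hp
  nlinarith

theorem hasFDerivAt_squareMap {p : ℝ × ℝ} (hp : p ∈ Set.Ioo (0 : ℝ) 1 ×ˢ Set.Ioo (0 : ℝ) 1) :
    HasFDerivAt squareMap (squareMapDeriv p) p := by
  unfold squareMapDeriv
  rw [Matrix.toLin_finTwoProd_toContinuousLinearMap]
  have h0 := (one_sub_mul_pos hp).ne'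
  have hm : HasFDerivAt (fun p : ℝ × ℝ => p.1 * p.2) _ p :=
    hasFDerivAt_fst.mul (hasFDerivAt_snd (𝕜 := ℝ) (p := p))
  have hd := ((hasFDerivAt_fst (𝕜 := ℝ) (p := p)).const_sub 1).mul
    ((hasDerivAt_inv h0).comp_hasFDerivAt p (hm.const_sub 1))
  refine (hm.prodMk hd).congr_fderiv ?_
  ext <;> simp <;> field_simp <;> ring

theorem det_squareMapDeriv {p : ℝ × ℝ} (hp : p ∈ Set.Ioo (0 : ℝ) 1 ×ˢ Set.Ioo (0 : ℝ) 1) :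
    |(squareMapDeriv p).det| = p.1 / (1 - p.1 * p.2) := by
  have h0 := one_sub_mul_pos hp
  rw [squareMapDeriv, ContinuousLinearMap.det, LinearMap.coe_toContinuousLinearMap,
    LinearMap.det_toLin, Matrix.det_fin_two_of]
  have : p.2 * ((1 - p.1) * p.1 / (1 - p.1 * p.2) ^ 2) - p.1 * (-(1 - p.2) / (1 - p.1 * p.2) ^ 2) =
      p.1 / (1 - p.1 * p.2) := by
    rw [neg_div, mul_neg, sub_neg_eq_add, mul_div_assoc', mul_div_assoc', ← add_div,
      div_eq_div_iff (pow_ne_zero 2 h0.ne') h0.ne']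
    ring
  rw [this, abs_of_pos (div_pos hp.1.1 h0)]

theorem injOn_squareMap :
    Set.InjOn squareMap (Set.Ioo (0 : ℝ) 1 ×ˢ Set.Ioo (0 : ℝ) 1) := by
  rintro ⟨q, t⟩ hp ⟨q', t'⟩ hp' h
  have h0 := one_sub_mul_pos hp
  simp only [squareMap, Prod.mk.injEq] at h h0
  obtain ⟨h1, h2⟩ := h
  rw [← h1, div_left_inj' h0.ne', sub_right_inj] at h2
  subst h2
  rw [mul_right_inj' hp.1.1.ne'] at h1
  rw [h1]

theorem image_squareMap :
    squareMap '' (Set.Ioo (0 : ℝ) 1 ×ˢ Set.Ioo (0 : ℝ) 1) =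
      Set.Ioo (0 : ℝ) 1 ×ˢ Set.Ioo (0 : ℝ) 1 := by
  ext ⟨s, y⟩
  constructor
  · rintro ⟨⟨q, t⟩, hp, h⟩
    have h0 := one_sub_mul_pos hp
    obtain ⟨⟨h1, h2⟩, h3, h4⟩ := hp
    simp only [squareMap, Prod.mk.injEq] at h h0 h1 h2 h3 h4
    obtain ⟨rfl, rfl⟩ := h
    refine ⟨⟨by positivity, by linarith⟩, div_pos (by linarith) h0, ?_⟩
    simp only
    rw [div_lt_one h0]
    nlinarith
  · rintro ⟨⟨h1, h2⟩, h3, h4⟩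
    simp only at h1 h2 h3 h4
    have hq : 0 < 1 - y * (1 - s) := by nlinarith
    have hq' : s < 1 - y * (1 - s) := by nlinarith
    -- Since `y (1 - s) = 1 - q`, the inverse map is `q = 1 - y (1 - s)`, `t = s / q`.
    refine ⟨(1 - y * (1 - s), s / (1 - y * (1 - s))),
      ⟨⟨hq, by simp only; nlinarith⟩, div_pos h1 hq, ?_⟩, ?_⟩
    · simp only
      rwa [div_lt_one hq]
    · have : (1 : ℝ) - s ≠ 0 := by linarith
      simp only [squareMap, Prod.mk.injEq]
      rw [mul_div_cancel₀ _ hq.ne']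
      refine ⟨rfl, ?_⟩
      field_simp
      ring

theorem integrableOn_squareMap_iff (F : ℝ × ℝ → ℂ) :
    IntegrableOn F (Set.Ioo (0 : ℝ) 1 ×ˢ Set.Ioo (0 : ℝ) 1) ↔
      IntegrableOn (fun p : ℝ × ℝ => ((p.1 / (1 - p.1 * p.2) : ℝ) : ℂ) * F (squareMap p))
        (Set.Ioo (0 : ℝ) 1 ×ˢ Set.Ioo (0 : ℝ) 1) := by
  have hm : MeasurableSet (Set.Ioo (0 : ℝ) 1 ×ˢ Set.Ioo (0 : ℝ) 1) :=
    measurableSet_Ioo.prod measurableSet_Ioo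
  conv_lhs => rw [← image_squareMap]
  rw [integrableOn_image_iff_integrableOn_abs_det_fderiv_smul volume hm
    (fun p hp => (hasFDerivAt_squareMap hp).hasFDerivWithinAt) injOn_squareMap]
  refine integrableOn_congr_fun (fun p hp => ?_) hm
  simp only [det_squareMapDeriv hp, real_smul]

theorem setIntegral_squareMap (F : ℝ × ℝ → ℂ) :
    ∫ p in Set.Ioo (0 : ℝ) 1 ×ˢ Set.Ioo (0 : ℝ) 1, F p =
      ∫ p in Set.Ioo (0 : ℝ) 1 ×ˢ Set.Ioo (0 : ℝ) 1,
        ((p.1 / (1 - p.1 * p.2) : ℝ) : ℂ) * F (squareMap p) := by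
  have hm : MeasurableSet (Set.Ioo (0 : ℝ) 1 ×ˢ Set.Ioo (0 : ℝ) 1) :=
    measurableSet_Ioo.prod measurableSet_Ioo
  conv_lhs => rw [← image_squareMap]
  rw [integral_image_eq_integral_abs_det_fderiv_smul volume hm
    (fun p hp => (hasFDerivAt_squareMap hp).hasFDerivWithinAt) injOn_squareMap]
  refine setIntegral_congr_fun hm fun p hp => ?_
  simp only [det_squareMapDeriv hp, real_smul]

/-! ### Powers of positive reals, and Fubini on the square. -/

theorem ofReal_cpow_eq_exp {x : ℝ} (hx : 0 < x) (s : ℂ) :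
    (x : ℂ) ^ s = Complex.exp (Real.log x * s) := by
  rw [cpow_def_of_ne_zero (ofReal_ne_zero.2 hx.ne'), ofReal_log hx.le]

theorem setIntegral_Ioo_prod {f : ℝ × ℝ → ℂ}
    (hf : IntegrableOn f (Set.Ioo (0 : ℝ) 1 ×ˢ Set.Ioo (0 : ℝ) 1)) :
    ∫ p in Set.Ioo (0 : ℝ) 1 ×ˢ Set.Ioo (0 : ℝ) 1, f p =
      ∫ x in Set.Ioo (0 : ℝ) 1, ∫ y in Set.Ioo (0 : ℝ) 1, f (x, y) := by
  rw [Measure.volume_eq_prod] at hf ⊢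
  exact setIntegral_prod f hf

theorem integrableOn_Ioo_integral {f : ℝ × ℝ → ℂ}
    (hf : IntegrableOn f (Set.Ioo (0 : ℝ) 1 ×ˢ Set.Ioo (0 : ℝ) 1)) :
    IntegrableOn (fun x => ∫ y in Set.Ioo (0 : ℝ) 1, f (x, y)) (Set.Ioo (0 : ℝ) 1) := by
  rw [IntegrableOn, Measure.volume_eq_prod, ← Measure.prod_restrict] at hf
  exact hf.integral_prod_left

theorem integrableOn_Ioo_mul_prod {f g : ℝ → ℂ} (hf : IntegrableOn f (Set.Ioo (0 : ℝ) 1))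
    (hg : IntegrableOn g (Set.Ioo (0 : ℝ) 1)) :
    IntegrableOn (fun p : ℝ × ℝ => f p.1 * g p.2) (Set.Ioo (0 : ℝ) 1 ×ˢ Set.Ioo (0 : ℝ) 1) := by
  rw [IntegrableOn, Measure.volume_eq_prod, ← Measure.prod_restrict]
  exact Integrable.mul_prod hf hg

theorem setIntegral_Ioo_mul_prod (f g : ℝ → ℂ) :
    ∫ p in Set.Ioo (0 : ℝ) 1 ×ˢ Set.Ioo (0 : ℝ) 1, f p.1 * g p.2 =
      (∫ x in Set.Ioo (0 : ℝ) 1, f x) * ∫ y in Set.Ioo (0 : ℝ) 1, g y := by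
  rw [Measure.volume_eq_prod]
  exact setIntegral_prod_mul f g _ _

theorem measurableSet_Ioo_prod_Ioo :
    MeasurableSet (Set.Ioo (0 : ℝ) 1 ×ˢ Set.Ioo (0 : ℝ) 1) :=
  measurableSet_Ioo.prod measurableSet_Ioo

/-! ### Euler's integral and the product of two beta variables. -/

/-- Euler's integral, by termwise integration of the binomial series; `₂F₁` is a power series sum
here, whence `‖z‖ < 1`. -/
theorem integral_betaKernel_mul_one_sub_cpow (α : ℂ) {β γ : ℂ} (hβ : 0 < β.re)
    (hγ : 0 < γ.re) {z : ℂ} (hz : ‖z‖ < 1) :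
    ∫ w in Set.Ioo (0 : ℝ) 1, betaKernel β γ w * (1 - w * z) ^ (-α) =
      Gamma β * Gamma γ / Gamma (β + γ) * ₂F₁ α β (β + γ) z := by
  have hu : ∀ᵐ t ∂(volume.restrict (Set.Ioo (0 : ℝ) 1)), t ∈ Set.Icc (0 : ℝ) 1 :=
    (ae_restrict_mem measurableSet_Ioo).mono fun t ht => Set.Ioo_subset_Icc_self ht
  have h := hasSum_integral_mul_one_sub_cpow (integrableOn_betaKernel hβ hγ)
    (u := fun t => t) aestronglyMeasurable_id hu α hz
  rw [← h.tsum_eq, ordinaryHypergeometric_eq_tsum, ← tsum_mul_left]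
  refine tsum_congr fun n => ?_
  have hn := integral_betaKernel_mul_pow hβ hγ n 0
  simp only [pow_zero, mul_one, add_zero] at hn
  rw [hn]
  simp only [shiftedFactorial, ascPochhammer_zero, Polynomial.eval_one, smul_eq_mul]
  ring

/-- The integrand whose integral over the second variable is the density of the product of two
independent variables with beta densities. -/
def mulBetaIntegrand (a₁ a₃ b₁ b₃ : ℂ) (p : ℝ × ℝ) : ℂ :=
  (p.1 : ℂ) ^ (a₃ - 1) * (1 - p.1 : ℂ) ^ (b₁ + b₃ - a₁ - a₃ - 1) *
    (betaKernel (b₁ - a₁) (b₃ - a₃) p.2 * (1 - p.2 * (1 - p.1)) ^ (-(b₃ - a₁)))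

/-- The density of the product of two independent variables with beta densities, up to a
constant factor. -/
def mulBetaKernel (a₁ a₃ b₁ b₃ : ℂ) (p : ℝ) : ℂ :=
  (p : ℂ) ^ (a₃ - 1) * (1 - p : ℂ) ^ (b₁ + b₃ - a₁ - a₃ - 1) *
    ₂F₁ (b₃ - a₁) (b₁ - a₁) (b₁ + b₃ - a₁ - a₃) (1 - p : ℂ)

/-- With `(p, w) = squareMap (q, t)` one has `1 - w (1 - p) = q`, so every factor is a power of `q`,
`t`, `1 - q`, `1 - t` or `1 - q t`, and the powers of `1 - q t` cancel. -/
theorem mulBetaIntegrand_squareMap (a₁ a₃ b₁ b₃ : ℂ) {p : ℝ × ℝ}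
    (hp : p ∈ Set.Ioo (0 : ℝ) 1 ×ˢ Set.Ioo (0 : ℝ) 1) :
    ((p.1 / (1 - p.1 * p.2) : ℝ) : ℂ) * mulBetaIntegrand a₁ a₃ b₁ b₃ (squareMap p) =
      betaKernel a₁ (b₁ - a₁) p.1 * betaKernel a₃ (b₃ - a₃) p.2 := by
  have hr := one_sub_mul_pos hp
  obtain ⟨q, t⟩ := p
  obtain ⟨⟨hq, hq'⟩, ht, ht'⟩ := hp
  simp only at hr hq hq' ht ht'
  have hq1 : 0 < 1 - q := by linarith
  have ht1 : 0 < 1 - t := by linarith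
  have e1 : (1 - ((q * t : ℝ) : ℂ)) = ((1 - q * t : ℝ) : ℂ) := by push_cast; ring
  have e2 : (1 - (((1 - q) / (1 - q * t) : ℝ) : ℂ)) = ((q * (1 - t) / (1 - q * t) : ℝ) : ℂ) := by
    rw [← ofReal_one, ← ofReal_sub]
    congr 1
    field_simp
    ring
  have e3 : (1 - (((1 - q) / (1 - q * t) : ℝ) : ℂ) * ((1 - q * t : ℝ) : ℂ)) = (q : ℂ) := by
    rw [← ofReal_mul, div_mul_cancel₀ _ hr.ne']
    push_cast
    ring
  have e4 : (1 - (q : ℂ)) = ((1 - q : ℝ) : ℂ) := by push_cast; ring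
  have e5 : (1 - (t : ℂ)) = ((1 - t : ℝ) : ℂ) := by push_cast; ring
  simp only [mulBetaIntegrand, betaKernel, squareMap, e1, e2, e3, e4, e5]
  -- All bases are positive, so both sides become exponentials of linear combinations of logarithms;
  -- the Jacobian joins in as a first power.
  rw [ofReal_cpow_eq_exp (mul_pos hq ht), ofReal_cpow_eq_exp hr, ofReal_cpow_eq_exp (div_pos hq1 hr),
    ofReal_cpow_eq_exp (div_pos (mul_pos hq ht1) hr), ofReal_cpow_eq_exp hq,
    ofReal_cpow_eq_exp hq, ofReal_cpow_eq_exp hq1, ofReal_cpow_eq_exp ht,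
    ofReal_cpow_eq_exp ht1, ← cpow_one ((q / (1 - q * t) : ℝ) : ℂ),
    ofReal_cpow_eq_exp (div_pos hq hr), Real.log_div (mul_pos hq ht1).ne' hr.ne',
    Real.log_div hq1.ne' hr.ne', Real.log_div hq.ne' hr.ne', Real.log_mul hq.ne' ht.ne',
    Real.log_mul hq.ne' ht1.ne']
  simp only [← Complex.exp_add]
  congr 1
  push_cast
  ring

theorem setIntegral_mulBetaIntegrand {a₁ a₃ b₁ b₃ : ℂ} (hb₁ : a₁.re < b₁.re)
    (hb₃ : a₃.re < b₃.re) {p : ℝ} (hp : p ∈ Set.Ioo (0 : ℝ) 1) :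
    ∫ w in Set.Ioo (0 : ℝ) 1, mulBetaIntegrand a₁ a₃ b₁ b₃ (p, w) =
      Gamma (b₁ - a₁) * Gamma (b₃ - a₃) / Gamma (b₁ + b₃ - a₁ - a₃) *
        mulBetaKernel a₁ a₃ b₁ b₃ p := by
  have hz : ‖(1 - p : ℂ)‖ < 1 := by
    rw [← ofReal_one, ← ofReal_sub, norm_real, Real.norm_of_nonneg (sub_nonneg.2 hp.2.le)]
    linarith [hp.1]
  simp only [mulBetaIntegrand]
  rw [integral_const_mul, integral_betaKernel_mul_one_sub_cpow _ (by simpa using hb₁)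
    (by simpa using hb₃) hz, mulBetaKernel,
    show b₁ - a₁ + (b₃ - a₃) = b₁ + b₃ - a₁ - a₃ by ring]
  ring

theorem integrableOn_mulBetaIntegrand {a₁ a₃ b₁ b₃ : ℂ} (ha₁ : 0 < a₁.re) (ha₃ : 0 < a₃.re)
    (hb₁ : a₁.re < b₁.re) (hb₃ : a₃.re < b₃.re) :
    IntegrableOn (mulBetaIntegrand a₁ a₃ b₁ b₃) (Set.Ioo (0 : ℝ) 1 ×ˢ Set.Ioo (0 : ℝ) 1) := by
  rw [integrableOn_squareMap_iff]
  refine (integrableOn_congr_fun (fun p hp => mulBetaIntegrand_squareMap a₁ a₃ b₁ b₃ hp)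
    measurableSet_Ioo_prod_Ioo).2 ?_
  exact integrableOn_Ioo_mul_prod (integrableOn_betaKernel ha₁ (by simpa using hb₁))
    (integrableOn_betaKernel ha₃ (by simpa using hb₃))

/-- Fubini gives integrability of the marginal, so no asymptotics of `₂F₁` near argument `1` are
needed. -/
theorem integrableOn_mulBetaKernel {a₁ a₃ b₁ b₃ : ℂ} (ha₁ : 0 < a₁.re) (ha₃ : 0 < a₃.re)
    (hb₁ : a₁.re < b₁.re) (hb₃ : a₃.re < b₃.re) :
    IntegrableOn (mulBetaKernel a₁ a₃ b₁ b₃) (Set.Ioo (0 : ℝ) 1) := by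
  have h := integrableOn_Ioo_integral (integrableOn_mulBetaIntegrand ha₁ ha₃ hb₁ hb₃)
  have h2 := (integrableOn_congr_fun (fun p hp => setIntegral_mulBetaIntegrand hb₁ hb₃ hp)
    measurableSet_Ioo).1 h
  refine (integrable_const_mul_iff (IsUnit.mk0 _ ?_) _).1 h2
  refine div_ne_zero (mul_ne_zero ?_ ?_) ?_ <;> refine Gamma_ne_zero_of_re_pos ?_ <;> simp <;>
    linarith

/-- The `n`-th moment of a product of independent variables is the product of the moments: `p ^ n`
pulls back to `q ^ n * t ^ n` under `squareMap`. -/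
theorem setIntegral_mulBetaKernel_mul_pow {a₁ a₃ b₁ b₃ : ℂ} (ha₁ : 0 < a₁.re) (ha₃ : 0 < a₃.re)
    (hb₁ : a₁.re < b₁.re) (hb₃ : a₃.re < b₃.re)
    (n : ℕ) :
    ∫ p in Set.Ioo (0 : ℝ) 1, mulBetaKernel a₁ a₃ b₁ b₃ p * (p : ℂ) ^ n =
      Gamma a₁ * Gamma a₃ * Gamma (b₁ + b₃ - a₁ - a₃) / (Gamma b₁ * Gamma b₃) *
        (shiftedFactorial a₁ n / shiftedFactorial b₁ n *
          (shiftedFactorial a₃ n / shiftedFactorial b₃ n)) := by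
  have h0 := integrableOn_mulBetaIntegrand ha₁ ha₃ hb₁ hb₃
  have h1 : IntegrableOn (fun p : ℝ × ℝ => mulBetaIntegrand a₁ a₃ b₁ b₃ p * (p.1 : ℂ) ^ n)
      (Set.Ioo (0 : ℝ) 1 ×ˢ Set.Ioo (0 : ℝ) 1) := by
    refine Integrable.mul_bdd (c := 1) h0 (by fun_prop) ?_
    filter_upwards [ae_restrict_mem measurableSet_Ioo_prod_Ioo] with p hp
    simpa [abs_of_pos hp.1.1] using pow_le_one₀ hp.1.1.le hp.1.2.le
  have h2 := setIntegral_Ioo_prod h1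
  rw [setIntegral_squareMap, setIntegral_congr_fun (g := fun p : ℝ × ℝ =>
    betaKernel a₁ (b₁ - a₁) p.1 * (p.1 : ℂ) ^ n *
      (betaKernel a₃ (b₃ - a₃) p.2 * (p.2 : ℂ) ^ n)) measurableSet_Ioo_prod_Ioo
    (fun p hp => ?_)] at h2
  swap
  · simp only [squareMap]
    rw [← mul_assoc, ← squareMap, mulBetaIntegrand_squareMap a₁ a₃ b₁ b₃ hp]
    push_cast
    ring
  rw [setIntegral_Ioo_mul_prod (fun q => betaKernel a₁ (b₁ - a₁) q * (q : ℂ) ^ n)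
    (fun t => betaKernel a₃ (b₃ - a₃) t * (t : ℂ) ^ n)] at h2
  have m₁ := integral_betaKernel_mul_pow ha₁ (b := b₁ - a₁) (by simpa using hb₁) n 0
  have m₃ := integral_betaKernel_mul_pow ha₃ (b := b₃ - a₃) (by simpa using hb₃) n 0
  simp only [pow_zero, mul_one, add_zero, add_sub_cancel, shiftedFactorial, ascPochhammer_zero,
    Polynomial.eval_one] at m₁ m₃
  simp only [integral_mul_const] at h2
  rw [m₁, m₃, setIntegral_congr_fun measurableSet_Ioo
    (fun (p : ℝ) hp => congrArg (· * (p : ℂ) ^ n) (setIntegral_mulBetaIntegrand hb₁ hb₃ hp))] at h2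
  simp only [mul_assoc (_ / _ : ℂ)] at h2
  rw [integral_const_mul] at h2
  have g1 : Gamma (b₁ - a₁) ≠ 0 := Gamma_ne_zero_of_re_pos (by simpa using hb₁)
  have g3 : Gamma (b₃ - a₃) ≠ 0 := Gamma_ne_zero_of_re_pos (by simpa using hb₃)
  have gc : Gamma (b₁ + b₃ - a₁ - a₃) ≠ 0 := Gamma_ne_zero_of_re_pos (by simp; linarith)
  have hc : Gamma (b₁ - a₁) * Gamma (b₃ - a₃) / Gamma (b₁ + b₃ - a₁ - a₃) ≠ 0 :=
    div_ne_zero (mul_ne_zero g1 g3) gc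
  -- The constant is the one from Euler's integral in `setIntegral_mulBetaIntegrand`.
  refine mul_left_cancel₀ hc (h2.symm.trans ?_)
  simp only [shiftedFactorial]
  field_simp

/-! ### The function `₄F₃` and the double integral. -/

theorem integrableOn_mulBetaKernel_mul_betaKernel {a₁ a₂ a₃ b₁ b₂ b₃ : ℂ}
    (ha₁ : 0 < a₁.re) (ha₂ : 0 < a₂.re) (ha₃ : 0 < a₃.re)
    (hb₁ : a₁.re < b₁.re) (hb₂ : a₂.re < b₂.re) (hb₃ : a₃.re < b₃.re) :
    IntegrableOn (fun p : ℝ × ℝ => mulBetaKernel a₁ a₃ b₁ b₃ p.1 * betaKernel a₂ (b₂ - a₂) p.2)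
      (Set.Ioo (0 : ℝ) 1 ×ˢ Set.Ioo (0 : ℝ) 1) :=
  integrableOn_Ioo_mul_prod (integrableOn_mulBetaKernel ha₁ ha₃ hb₁ hb₃)
    (integrableOn_betaKernel ha₂ (by simpa using hb₂))

theorem ae_mul_mem_Icc : ∀ᵐ p : ℝ × ℝ
    ∂(volume.restrict (Set.Ioo (0 : ℝ) 1 ×ˢ Set.Ioo (0 : ℝ) 1)),
    p.1 * p.2 ∈ Set.Icc (0 : ℝ) 1 :=
  (ae_restrict_mem measurableSet_Ioo_prod_Ioo).mono fun _ hp =>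
    ⟨mul_nonneg hp.1.1.le hp.2.1.le, mul_le_one₀ hp.1.2.le hp.2.1.le hp.2.2.le⟩

theorem ae_one_sub_mem_Icc : ∀ᵐ p : ℝ × ℝ
    ∂(volume.restrict (Set.Ioo (0 : ℝ) 1 ×ˢ Set.Ioo (0 : ℝ) 1)),
    1 - p.1 ∈ Set.Icc (0 : ℝ) 1 :=
  (ae_restrict_mem measurableSet_Ioo_prod_Ioo).mono fun _ hp =>
    ⟨sub_nonneg.2 hp.1.2.le, sub_le_self _ hp.1.1.le⟩

/-- The integral is the expectation of `(1 - X₁ X₂ X₃ z) ^ (-σ)`, with `p.1 = X₁ X₃` and `p.2 = X₂`;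
in the disc its expansion has the moments of the product as coefficients. -/
theorem isHolomorphicContinuation_hypergeometricSeries (σ : ℂ) {a₁ a₂ a₃ b₁ b₂ b₃ : ℂ}
    (ha₁ : 0 < a₁.re) (ha₂ : 0 < a₂.re) (ha₃ : 0 < a₃.re)
    (hb₁ : a₁.re < b₁.re) (hb₂ : a₂.re < b₂.re) (hb₃ : a₃.re < b₃.re) :
    IsHolomorphicContinuation (hypergeometricSeries ![σ, a₁, a₂, a₃] ![b₁, b₂, b₃]) cutPlane
      fun z => Gamma b₁ * Gamma b₂ * Gamma b₃ /
          (Gamma a₁ * Gamma a₂ * Gamma a₃ * Gamma (b₂ - a₂) * Gamma (b₁ + b₃ - a₁ - a₃)) *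
        ∫ p in Set.Ioo (0 : ℝ) 1 ×ˢ Set.Ioo (0 : ℝ) 1,
          mulBetaKernel a₁ a₃ b₁ b₃ p.1 * betaKernel a₂ (b₂ - a₂) p.2 *
            (1 - (p.1 * p.2 : ℝ) * z) ^ (-σ) := by
  have hg := integrableOn_mulBetaKernel_mul_betaKernel ha₁ ha₂ ha₃ hb₁ hb₂ hb₃
  have hu : AEStronglyMeasurable (fun p : ℝ × ℝ => p.1 * p.2)
      (volume.restrict (Set.Ioo (0 : ℝ) 1 ×ˢ Set.Ioo (0 : ℝ) 1)) := by fun_prop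
  refine ⟨(differentiableOn_integral_mul_one_sub_cpow hg hu ae_mul_mem_Icc σ).const_mul _, ?_⟩
  rintro z ⟨hz, -⟩
  rw [mem_ball_zero_iff] at hz
  have h := hasSum_integral_mul_one_sub_cpow hg hu ae_mul_mem_Icc σ hz
  simp only
  rw [← h.tsum_eq, ← tsum_mul_left, hypergeometricSeries]
  refine tsum_congr fun n => ?_
  have hm : ∫ p in Set.Ioo (0 : ℝ) 1 ×ˢ Set.Ioo (0 : ℝ) 1,
      mulBetaKernel a₁ a₃ b₁ b₃ p.1 * betaKernel a₂ (b₂ - a₂) p.2 * ((p.1 * p.2 : ℝ) : ℂ) ^ n =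
      (∫ p in Set.Ioo (0 : ℝ) 1, mulBetaKernel a₁ a₃ b₁ b₃ p * (p : ℂ) ^ n) *
        ∫ t in Set.Ioo (0 : ℝ) 1, betaKernel a₂ (b₂ - a₂) t * (t : ℂ) ^ n := by
    rw [← setIntegral_Ioo_mul_prod]
    congr 1
    ext p
    push_cast
    ring
  have m₂ := integral_betaKernel_mul_pow ha₂ (b := b₂ - a₂) (by simpa using hb₂) n 0
  have hs0 : ∀ a, shiftedFactorial a 0 = 1 := fun a => by simp [shiftedFactorial]
  simp only [pow_zero, mul_one, add_zero, add_sub_cancel, hs0] at m₂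
  rw [hm, m₂, setIntegral_mulBetaKernel_mul_pow ha₁ ha₃ hb₁ hb₃]
  have p₁ : 0 < b₁.re := ha₁.trans hb₁
  have p₂ : 0 < b₂.re := ha₂.trans hb₂
  have p₃ : 0 < b₃.re := ha₃.trans hb₃
  have g1 := Gamma_ne_zero_of_re_pos ha₁
  have g2 := Gamma_ne_zero_of_re_pos ha₂
  have g3 := Gamma_ne_zero_of_re_pos ha₃
  have k1 := Gamma_ne_zero_of_re_pos p₁
  have k2 := Gamma_ne_zero_of_re_pos p₂
  have k3 := Gamma_ne_zero_of_re_pos p₃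
  have gd : Gamma (b₂ - a₂) ≠ 0 := Gamma_ne_zero_of_re_pos (by simpa using hb₂)
  have gc : Gamma (b₁ + b₃ - a₁ - a₃) ≠ 0 := Gamma_ne_zero_of_re_pos (by simp; linarith)
  have s1 := shiftedFactorial_ne_zero p₁ n
  have s2 := shiftedFactorial_ne_zero p₂ n
  have s3 := shiftedFactorial_ne_zero p₃ n
  have hn : (n ! : ℂ) ≠ 0 := by exact_mod_cast n.factorial_ne_zero
  have hp : ∏ i : Fin (3 + 1), shiftedFactorial (![σ, a₁, a₂, a₃] i) n =
      shiftedFactorial σ n * shiftedFactorial a₁ n * shiftedFactorial a₂ n *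
        shiftedFactorial a₃ n := Fin.prod_univ_four _
  simp only [hp, Fin.prod_univ_three, Matrix.cons_val]
  field_simp

/-- Here `q` stands for `X₁ X₃` and `t` for `X₂`. The argument `y (1 - s)` of `₂F₁` becomes `1 - q`,
and `1 - y (1 - s)` becomes `q`. -/
theorem doubleIntegrand_squareMap (σ a₁ a₂ a₃ b₁ b₂ b₃ z : ℂ) {p : ℝ × ℝ}
    (hp : p ∈ Set.Ioo (0 : ℝ) 1 ×ˢ Set.Ioo (0 : ℝ) 1) :
    ((p.1 / (1 - p.1 * p.2) : ℝ) : ℂ) * doubleIntegrand σ a₁ a₂ a₃ b₁ b₂ b₃ z (squareMap p) =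
      mulBetaKernel a₁ a₃ b₁ b₃ p.1 * betaKernel a₂ (b₂ - a₂) p.2 *
        (1 - (p.1 * p.2 : ℝ) * (-z)) ^ (-σ) := by
  have hr := one_sub_mul_pos hp
  obtain ⟨q, t⟩ := p
  obtain ⟨⟨hq, hq'⟩, ht, ht'⟩ := hp
  simp only at hr hq hq' ht ht'
  have hq1 : 0 < 1 - q := by linarith
  have ht1 : 0 < 1 - t := by linarith
  have e1 : (1 - ((q * t : ℝ) : ℂ)) = ((1 - q * t : ℝ) : ℂ) := by push_cast; ring
  have e2 : (1 - (((1 - q) / (1 - q * t) : ℝ) : ℂ)) = ((q * (1 - t) / (1 - q * t) : ℝ) : ℂ) := by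
    rw [← ofReal_one, ← ofReal_sub]
    congr 1
    field_simp
    ring
  have e3 : (((1 - q) / (1 - q * t) : ℝ) : ℂ) * ((1 - q * t : ℝ) : ℂ) = ((1 - q : ℝ) : ℂ) := by
    rw [← ofReal_mul, div_mul_cancel₀ _ hr.ne']
  have e4 : (1 - (q : ℂ)) = ((1 - q : ℝ) : ℂ) := by push_cast; ring
  have e5 : (1 - (t : ℂ)) = ((1 - t : ℝ) : ℂ) := by push_cast; ring
  have e6 : (1 - ((1 - q : ℝ) : ℂ)) = (q : ℂ) := by push_cast; ring
  have e7 : (1 - ((q * t : ℝ) : ℂ) * (-z)) = 1 + ((q * t : ℝ) : ℂ) * z := by ring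
  simp only [doubleIntegrand, mulBetaKernel, betaKernel, squareMap, e1, e2, e3, e4, e5, e6, e7]
  -- The hypergeometric factor and the base of the `σ`-power occur identically on both sides; only
  -- powers of positive reals remain to be compared.
  generalize ₂F₁ (b₃ - a₁) (b₁ - a₁) (b₁ + b₃ - a₁ - a₃) (((1 - q : ℝ) : ℂ)) = F
  generalize 1 + ((q * t : ℝ) : ℂ) * z = Z
  have key : ((q / (1 - q * t) : ℝ) : ℂ) * (((q * t : ℝ) : ℂ) ^ (a₂ - 1) *
      (((1 - q) / (1 - q * t) : ℝ) : ℂ) ^ (b₁ + b₃ - a₁ - a₃ - 1) *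
      ((1 - q * t : ℝ) : ℂ) ^ (b₁ + b₂ + b₃ - a₁ - a₂ - a₃ - 1) *
      ((q * (1 - t) / (1 - q * t) : ℝ) : ℂ) ^ (b₂ - a₂ - 1) * (q : ℂ) ^ (-(b₂ - a₃))) =
      (q : ℂ) ^ (a₃ - 1) * ((1 - q : ℝ) : ℂ) ^ (b₁ + b₃ - a₁ - a₃ - 1) *
        ((t : ℂ) ^ (a₂ - 1) * ((1 - t : ℝ) : ℂ) ^ (b₂ - a₂ - 1)) := by
    rw [ofReal_cpow_eq_exp (mul_pos hq ht), ofReal_cpow_eq_exp hr,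
      ofReal_cpow_eq_exp (div_pos hq1 hr),
      ofReal_cpow_eq_exp (div_pos (mul_pos hq ht1) hr), ofReal_cpow_eq_exp hq,
      ofReal_cpow_eq_exp hq, ofReal_cpow_eq_exp hq1, ofReal_cpow_eq_exp ht,
      ofReal_cpow_eq_exp ht1, ← cpow_one ((q / (1 - q * t) : ℝ) : ℂ),
      ofReal_cpow_eq_exp (div_pos hq hr), Real.log_div (mul_pos hq ht1).ne' hr.ne',
      Real.log_div hq1.ne' hr.ne', Real.log_div hq.ne' hr.ne', Real.log_mul hq.ne' ht.ne',
      Real.log_mul hq.ne' ht1.ne']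
    simp only [← Complex.exp_add]
    congr 1
    push_cast
    ring
  rw [cpow_neg] at key ⊢
  linear_combination (F * (Z ^ σ)⁻¹) * key

theorem integrableOn_doubleIntegrand (σ : ℂ) {a₁ a₂ a₃ b₁ b₂ b₃ : ℂ}
    (ha₁ : 0 < a₁.re) (ha₂ : 0 < a₂.re) (ha₃ : 0 < a₃.re)
    (hb₁ : a₁.re < b₁.re) (hb₂ : a₂.re < b₂.re) (hb₃ : a₃.re < b₃.re) {z : ℂ}
    (hz : -z ∈ cutPlane) :
    IntegrableOn (doubleIntegrand σ a₁ a₂ a₃ b₁ b₂ b₃ z)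
      (Set.Ioo (0 : ℝ) 1 ×ˢ Set.Ioo (0 : ℝ) 1) := by
  rw [integrableOn_squareMap_iff, integrableOn_congr_fun (fun p hp =>
    doubleIntegrand_squareMap σ a₁ a₂ a₃ b₁ b₂ b₃ z hp) measurableSet_Ioo_prod_Ioo]
  exact integrable_mul_one_sub_cpow
    (integrableOn_mulBetaKernel_mul_betaKernel ha₁ ha₂ ha₃ hb₁ hb₂ hb₃)
    (u := fun p : ℝ × ℝ => p.1 * p.2) (by fun_prop) ae_mul_mem_Icc (-σ) hz

theorem hypergeometricFun_eq_integral_doubleIntegrand (σ : ℂ) {a₁ a₂ a₃ b₁ b₂ b₃ : ℂ}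
    (ha₁ : 0 < a₁.re) (ha₂ : 0 < a₂.re) (ha₃ : 0 < a₃.re)
    (hb₁ : a₁.re < b₁.re) (hb₂ : a₂.re < b₂.re) (hb₃ : a₃.re < b₃.re) {z : ℂ}
    (hz : -z ∈ cutPlane) :
    hypergeometricFun ![σ, a₁, a₂, a₃] ![b₁, b₂, b₃] (-z) =
      Gamma b₁ * Gamma b₂ * Gamma b₃ /
          (Gamma a₁ * Gamma a₂ * Gamma a₃ * Gamma (b₂ - a₂) * Gamma (b₁ + b₃ - a₁ - a₃)) *
        ∫ p in Set.Ioo (0 : ℝ) 1 ×ˢ Set.Ioo (0 : ℝ) 1,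
          doubleIntegrand σ a₁ a₂ a₃ b₁ b₂ b₃ z p := by
  rw [hypergeometricFun, (isHolomorphicContinuation_hypergeometricSeries σ ha₁ ha₂ ha₃ hb₁ hb₂
    hb₃).holomorphicContinuation_apply isOpen_cutPlane starConvex_cutPlane hz,
    setIntegral_squareMap (doubleIntegrand σ a₁ a₂ a₃ b₁ b₂ b₃ z), setIntegral_congr_fun measurableSet_Ioo_prod_Ioo
      fun p hp => doubleIntegrand_squareMap σ a₁ a₂ a₃ b₁ b₂ b₃ z hp]

/-! ### Integral representations of Appell's `F₃`. -/

theorem isOpen_cutPlane_prod : IsOpen (cutPlane ×ˢ cutPlane) :=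
  isOpen_cutPlane.prod isOpen_cutPlane

theorem starConvex_cutPlane_prod : StarConvex ℝ 0 (cutPlane ×ˢ cutPlane) :=
  starConvex_cutPlane.prod starConvex_cutPlane

theorem integrableOn_appellF3_density {β₁ β₂ γ : ℂ} (hβ₁ : 0 < β₁.re) (hβ₂ : 0 < β₂.re)
    (hγ : β₁.re + β₂.re < γ.re) :
    IntegrableOn (fun p : ℝ × ℝ => betaKernel (γ - β₁) β₁ p.1 *
      betaKernel β₂ (γ - β₁ - β₂) p.2) (Set.Ioo (0 : ℝ) 1 ×ˢ Set.Ioo (0 : ℝ) 1) :=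
  integrableOn_Ioo_mul_prod (integrableOn_betaKernel (by simp; linarith) hβ₁)
    (integrableOn_betaKernel hβ₂ (by simp; linarith))

/-- A Dirichlet integral over the simplex in the coordinates `(1 - y, y w)`: the moment of `(1 - y)
^ k * (y w) ^ l` splits into two beta moments. The factors `(γ - β₁)_l` cancel, leaving `(γ)_{k+l}`
in the denominator. -/
theorem isHolomorphicContinuation_appellF3Series (α₁ α₂ : ℂ) {β₁ β₂ γ : ℂ} (hβ₁ : 0 < β₁.re)
    (hβ₂ : 0 < β₂.re) (hγ : β₁.re + β₂.re < γ.re) :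
    IsHolomorphicContinuation (appellF3Series α₁ α₂ β₁ β₂ γ) (cutPlane ×ˢ cutPlane)
      fun w => Gamma γ / (Gamma β₁ * Gamma β₂ * Gamma (γ - β₁ - β₂)) *
        ∫ p in Set.Ioo (0 : ℝ) 1 ×ˢ Set.Ioo (0 : ℝ) 1,
          betaKernel (γ - β₁) β₁ p.1 * betaKernel β₂ (γ - β₁ - β₂) p.2 *
            ((1 - (1 - p.1 : ℝ) * w.1) ^ (-α₁) * (1 - (p.1 * p.2 : ℝ) * w.2) ^ (-α₂)) := by
  have hg := integrableOn_appellF3_density hβ₁ hβ₂ hγ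
  have hu₁ : AEStronglyMeasurable (fun p : ℝ × ℝ => 1 - p.1)
      (volume.restrict (Set.Ioo (0 : ℝ) 1 ×ˢ Set.Ioo (0 : ℝ) 1)) := by fun_prop
  have hu₂ : AEStronglyMeasurable (fun p : ℝ × ℝ => p.1 * p.2)
      (volume.restrict (Set.Ioo (0 : ℝ) 1 ×ˢ Set.Ioo (0 : ℝ) 1)) := by fun_prop
  refine ⟨(differentiableOn_integral_mul_one_sub_cpow_mul hg hu₁ hu₂ ae_one_sub_mem_Icc
    ae_mul_mem_Icc α₁ α₂).const_mul _, ?_⟩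
  rintro ⟨z₁, z₂⟩ ⟨hz, -⟩
  rw [mem_ball_zero_iff, Prod.norm_mk, max_lt_iff] at hz
  have h := hasSum_integral_mul_one_sub_cpow_mul hg hu₁ hu₂ ae_one_sub_mem_Icc
    ae_mul_mem_Icc α₁ α₂ hz.1 hz.2
  simp only
  rw [← h.tsum_eq, ← tsum_mul_left, appellF3Series]
  refine tsum_congr fun ⟨k, l⟩ => ?_
  have hγβ : 0 < (γ - β₁).re := by simp; linarith
  have hγ' : 0 < (γ - β₁ - β₂).re := by simp; linarith
  have hm : ∫ p in Set.Ioo (0 : ℝ) 1 ×ˢ Set.Ioo (0 : ℝ) 1,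
      betaKernel (γ - β₁) β₁ p.1 * betaKernel β₂ (γ - β₁ - β₂) p.2 *
        (((1 - p.1 : ℝ) : ℂ) ^ k * ((p.1 * p.2 : ℝ) : ℂ) ^ l) =
      (∫ y in Set.Ioo (0 : ℝ) 1, betaKernel (γ - β₁) β₁ y * ((y : ℂ) ^ l * (1 - y : ℂ) ^ k)) *
        ∫ w in Set.Ioo (0 : ℝ) 1,
          betaKernel β₂ (γ - β₁ - β₂) w * ((w : ℂ) ^ l * (1 - w : ℂ) ^ 0) := by
    rw [← setIntegral_Ioo_mul_prod]
    congr 1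
    ext p
    push_cast
    ring
  simp only
  rw [hm, integral_betaKernel_mul_pow hγβ hβ₁, integral_betaKernel_mul_pow hβ₂ hγ']
  have hs0 : ∀ a, shiftedFactorial a 0 = 1 := fun a => by simp [shiftedFactorial]
  simp only [add_zero, hs0, mul_one, sub_add_cancel, add_sub_cancel, add_comm l k]
  have g1 := Gamma_ne_zero_of_re_pos hβ₁
  have g2 := Gamma_ne_zero_of_re_pos hβ₂
  have g3 := Gamma_ne_zero_of_re_pos hγβ
  have g4 := Gamma_ne_zero_of_re_pos hγ'
  have g5 : Gamma γ ≠ 0 := Gamma_ne_zero_of_re_pos (by linarith)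
  have s1 := shiftedFactorial_ne_zero hγβ l
  have s2 : shiftedFactorial γ (k + l) ≠ 0 := shiftedFactorial_ne_zero (by linarith) _
  have hk : (k ! : ℂ) ≠ 0 := by exact_mod_cast k.factorial_ne_zero
  have hl : (l ! : ℂ) ≠ 0 := by exact_mod_cast l.factorial_ne_zero
  field_simp

/-- Euler's integral carries out the integration over `w`. Only the second variable must lie in the
unit disc, which leaves room for `z₁ = 1 - 1/s`. -/
theorem appellF3_eq_integral (α₁ α₂ : ℂ) {β₁ β₂ γ : ℂ} (hβ₁ : 0 < β₁.re)
    (hβ₂ : 0 < β₂.re) (hγ : β₁.re + β₂.re < γ.re) {z₁ z₂ : ℂ} (hz₁ : z₁ ∈ cutPlane)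
    (hz₂ : ‖z₂‖ < 1) :
    appellF3 α₁ α₂ β₁ β₂ γ z₁ z₂ = Gamma γ / (Gamma β₁ * Gamma (γ - β₁)) *
      ∫ y in Set.Ioo (0 : ℝ) 1, betaKernel (γ - β₁) β₁ y *
        (1 - (1 - y : ℝ) * z₁) ^ (-α₁) * ₂F₁ α₂ β₂ (γ - β₁) (y * z₂) := by
  have hz₂' := mem_cutPlane_of_norm_lt_one hz₂
  rw [appellF3, (isHolomorphicContinuation_appellF3Series α₁ α₂ hβ₁ hβ₂
    hγ).holomorphicContinuation_apply isOpen_cutPlane_prod starConvex_cutPlane_prod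
    (Set.mk_mem_prod hz₁ hz₂')]
  have hγβ : 0 < (γ - β₁).re := by simp; linarith
  have hγ' : 0 < (γ - β₁ - β₂).re := by simp; linarith
  have hi := integrable_mul_one_sub_cpow (integrable_mul_one_sub_cpow
    (integrableOn_appellF3_density hβ₁ hβ₂ hγ) (u := fun p : ℝ × ℝ => 1 - p.1) (by fun_prop)
    ae_one_sub_mem_Icc (-α₁) hz₁) (u := fun p : ℝ × ℝ => p.1 * p.2) (by fun_prop)
    ae_mul_mem_Icc (-α₂) hz₂'
  simp only [← mul_assoc]
  rw [setIntegral_Ioo_prod hi]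
  have hy : ∀ y ∈ Set.Ioo (0 : ℝ) 1, ∫ w in Set.Ioo (0 : ℝ) 1,
      betaKernel (γ - β₁) β₁ y * betaKernel β₂ (γ - β₁ - β₂) w *
        (1 - (1 - y : ℝ) * z₁) ^ (-α₁) * (1 - (y * w : ℝ) * z₂) ^ (-α₂) =
      Gamma β₂ * Gamma (γ - β₁ - β₂) / Gamma (γ - β₁) * (betaKernel (γ - β₁) β₁ y *
        (1 - (1 - y : ℝ) * z₁) ^ (-α₁) * ₂F₁ α₂ β₂ (γ - β₁) (y * z₂)) := by
    intro y hy
    have hyz : ‖y * z₂‖ < 1 := by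
      rw [norm_mul, norm_real, Real.norm_of_nonneg hy.1.le]
      exact (mul_le_of_le_one_left (norm_nonneg _) hy.2.le).trans_lt hz₂
    have h := integral_betaKernel_mul_one_sub_cpow α₂ hβ₂ hγ' hyz
    rw [add_sub_cancel] at h
    calc _ = ∫ w in Set.Ioo (0 : ℝ) 1, betaKernel (γ - β₁) β₁ y *
          (1 - (1 - y : ℝ) * z₁) ^ (-α₁) *
          (betaKernel β₂ (γ - β₁ - β₂) w * (1 - w * (y * z₂)) ^ (-α₂)) := by
          congr 1
          ext w
          rw [show ((y * w : ℝ) : ℂ) * z₂ = w * (y * z₂) by push_cast; ring]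
          ring
      _ = _ := by
          rw [integral_const_mul, h]
          ring
  rw [setIntegral_congr_fun measurableSet_Ioo hy, integral_const_mul, ← mul_assoc]
  have g2 := Gamma_ne_zero_of_re_pos hβ₂
  have g4 := Gamma_ne_zero_of_re_pos hγ'
  congr 1
  field_simp

theorem one_sub_inv_mem_cutPlane {s : ℝ} (hs : 0 < s) : (1 - 1 / s : ℂ) ∈ cutPlane := by
  have : (1 - (1 - 1 / s : ℂ)) = ((1 / s : ℝ) : ℂ) := by push_cast; ring
  rw [cutPlane, Set.mem_ofPred_eq, this]
  exact ofReal_mem_slitPlane.2 (by positivity)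

/-! ### Integration over `y` and the single integral. -/

theorem setIntegral_doubleIntegrand (σ : ℂ) {a₁ a₂ a₃ b₁ b₂ b₃ : ℂ}
    (hb₁ : a₁.re < b₁.re) (hb₂ : a₂.re < b₂.re) (hb₃ : a₃.re < b₃.re) (z : ℂ) {s : ℝ}
    (hs : s ∈ Set.Ioo (0 : ℝ) 1) :
    ∫ y in Set.Ioo (0 : ℝ) 1, doubleIntegrand σ a₁ a₂ a₃ b₁ b₂ b₃ z (s, y) =
      Gamma (b₂ - a₂) * Gamma (b₁ + b₃ - a₁ - a₃) /
          Gamma (b₁ + b₂ + b₃ - a₁ - a₂ - a₃) *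
        singleIntegrand σ a₁ a₂ a₃ b₁ b₂ b₃ z s := by
  have hs2 : ‖(1 - s : ℂ)‖ < 1 := by
    rw [← ofReal_one, ← ofReal_sub, norm_real, Real.norm_of_nonneg (sub_nonneg.2 hs.2.le)]
    linarith [hs.1]
  have hc : b₁ + b₂ + b₃ - a₁ - a₂ - a₃ - (b₂ - a₂) = b₁ + b₃ - a₁ - a₃ := by ring
  have hF := appellF3_eq_integral (b₂ - a₃) (b₃ - a₁) (β₁ := b₂ - a₂) (β₂ := b₁ - a₁)
    (γ := b₁ + b₂ + b₃ - a₁ - a₂ - a₃) (by simpa using hb₂) (by simpa using hb₁)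
    (by simp; linarith) (one_sub_inv_mem_cutPlane hs.1) hs2
  rw [hc] at hF
  have g1 : Gamma (b₂ - a₂) ≠ 0 := Gamma_ne_zero_of_re_pos (by simpa using hb₂)
  have g2 : Gamma (b₁ + b₃ - a₁ - a₃) ≠ 0 := Gamma_ne_zero_of_re_pos (by simp; linarith)
  have g3 : Gamma (b₁ + b₂ + b₃ - a₁ - a₂ - a₃) ≠ 0 :=
    Gamma_ne_zero_of_re_pos (by simp; linarith)
  have hd : ∀ y ∈ Set.Ioo (0 : ℝ) 1, doubleIntegrand σ a₁ a₂ a₃ b₁ b₂ b₃ z (s, y) =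
      (s : ℂ) ^ (a₂ + a₃ - b₂ - 1) * (1 - s : ℂ) ^ (b₁ + b₂ + b₃ - a₁ - a₂ - a₃ - 1) /
        (1 + s * z) ^ σ * (betaKernel (b₁ + b₃ - a₁ - a₃) (b₂ - a₂) y *
        (1 - (1 - y : ℝ) * (1 - 1 / s)) ^ (-(b₂ - a₃)) *
        ₂F₁ (b₃ - a₁) (b₁ - a₁) (b₁ + b₃ - a₁ - a₃) (y * (1 - s) : ℂ)) := by
    intro y hy
    have hq : 0 < 1 - y * (1 - s) := by nlinarith [hy.1, hy.2, hs.1, hs.2]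
    have e1 : (1 - (1 - y : ℝ) * (1 - 1 / s : ℂ)) = (((1 - y * (1 - s)) / s : ℝ) : ℂ) := by
      have : (s : ℂ) ≠ 0 := ofReal_ne_zero.2 hs.1.ne'
      push_cast
      field_simp
      ring
    have e2 : (1 - y * (1 - s) : ℂ) = ((1 - y * (1 - s) : ℝ) : ℂ) := by push_cast; ring
    -- The identity `1 - (1 - y) (1 - 1/s) = (1 - y (1 - s)) / s` trades a power of `s` and so
    -- shifts its exponent from `a₂ - 1` to `a₂ + a₃ - b₂ - 1`.
    have key : (s : ℂ) ^ (a₂ - 1) * ((1 - y * (1 - s) : ℝ) : ℂ) ^ (-(b₂ - a₃)) =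
        (s : ℂ) ^ (a₂ + a₃ - b₂ - 1) * (((1 - y * (1 - s)) / s : ℝ) : ℂ) ^ (-(b₂ - a₃)) := by
      rw [ofReal_cpow_eq_exp hs.1, ofReal_cpow_eq_exp hs.1, ofReal_cpow_eq_exp hq,
        ofReal_cpow_eq_exp (div_pos hq hs.1), Real.log_div hq.ne' hs.1.ne',
        ← Complex.exp_add, ← Complex.exp_add]
      congr 1
      push_cast
      ring
    simp only [doubleIntegrand, betaKernel]
    rw [e1, e2]
    generalize ₂F₁ (b₃ - a₁) (b₁ - a₁) (b₁ + b₃ - a₁ - a₃) (y * (1 - s) : ℂ) = F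
    rw [cpow_neg ((1 - y * (1 - s) : ℝ) : ℂ)] at key
    linear_combination ((y : ℂ) ^ (b₁ + b₃ - a₁ - a₃ - 1) *
      (1 - s : ℂ) ^ (b₁ + b₂ + b₃ - a₁ - a₂ - a₃ - 1) * (1 - y : ℂ) ^ (b₂ - a₂ - 1) *
      ((1 + s * z) ^ σ)⁻¹ * F) * key
  rw [setIntegral_congr_fun measurableSet_Ioo hd, integral_const_mul, singleIntegrand, hF]
  generalize ∫ y in Set.Ioo (0 : ℝ) 1, betaKernel (b₁ + b₃ - a₁ - a₃) (b₂ - a₂) y *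
    (1 - (1 - y : ℝ) * (1 - 1 / s : ℂ)) ^ (-(b₂ - a₃)) *
    ₂F₁ (b₃ - a₁) (b₁ - a₁) (b₁ + b₃ - a₁ - a₃) (y * (1 - s) : ℂ) = J
  field_simp

end

theorem mainTheorem8 (σ a₁ a₂ a₃ b₁ b₂ b₃ : ℂ)
    (ha₁ : 0 < a₁.re) (ha₂ : 0 < a₂.re) (ha₃ : 0 < a₃.re)
    (hb₁ : a₁.re < b₁.re) (hb₂ : a₂.re < b₂.re) (hb₃ : a₃.re < b₃.re) :
    IsHolomorphicContinuation
        (hypergeometricSeries ![σ, a₁, a₂, a₃] ![b₁, b₂, b₃]) cutPlane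
        (hypergeometricFun ![σ, a₁, a₂, a₃] ![b₁, b₂, b₃]) ∧
    IsHolomorphicContinuation
        (appellF3Series (b₂ - a₃) (b₃ - a₁) (b₂ - a₂) (b₁ - a₁)
          (b₁ + b₂ + b₃ - a₁ - a₂ - a₃)) (cutPlane ×ˢ cutPlane)
        (fun w => appellF3 (b₂ - a₃) (b₃ - a₁) (b₂ - a₂) (b₁ - a₁)
          (b₁ + b₂ + b₃ - a₁ - a₂ - a₃) w.1 w.2) ∧
    ∀ z : ℂ, 1 + z ∈ Complex.slitPlane →
      (IntegrableOn (doubleIntegrand σ a₁ a₂ a₃ b₁ b₂ b₃ z)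
          (Set.Icc (0 : ℝ) 1 ×ˢ Set.Icc (0 : ℝ) 1) ∧
        hypergeometricFun ![σ, a₁, a₂, a₃] ![b₁, b₂, b₃] (-z) =
          Complex.Gamma b₁ * Complex.Gamma b₂ * Complex.Gamma b₃ /
              (Complex.Gamma a₁ * Complex.Gamma a₂ * Complex.Gamma a₃ *
                Complex.Gamma (b₂ - a₂) * Complex.Gamma (b₁ + b₃ - a₁ - a₃)) *
            ∫ p in Set.Icc (0 : ℝ) 1 ×ˢ Set.Icc (0 : ℝ) 1,
              doubleIntegrand σ a₁ a₂ a₃ b₁ b₂ b₃ z p) ∧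
      (IntegrableOn (singleIntegrand σ a₁ a₂ a₃ b₁ b₂ b₃ z) (Set.Icc (0 : ℝ) 1) ∧
        hypergeometricFun ![σ, a₁, a₂, a₃] ![b₁, b₂, b₃] (-z) =
          Complex.Gamma b₁ * Complex.Gamma b₂ * Complex.Gamma b₃ /
              (Complex.Gamma a₁ * Complex.Gamma a₂ * Complex.Gamma a₃ *
                Complex.Gamma (b₁ + b₂ + b₃ - a₁ - a₂ - a₃)) *
            ∫ s in Set.Icc (0 : ℝ) 1, singleIntegrand σ a₁ a₂ a₃ b₁ b₂ b₃ z s) := by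
  refine ⟨(isHolomorphicContinuation_hypergeometricSeries σ ha₁ ha₂ ha₃ hb₁ hb₂
      hb₃).holomorphicContinuation,
    (isHolomorphicContinuation_appellF3Series (b₂ - a₃) (b₃ - a₁) (β₁ := b₂ - a₂)
      (β₂ := b₁ - a₁) (γ := b₁ + b₂ + b₃ - a₁ - a₂ - a₃) (by simpa using hb₂)
      (by simpa using hb₁) (by simp; linarith)).holomorphicContinuation, fun z hz => ?_⟩
  have hz' : -z ∈ cutPlane := by simpa [cutPlane] using hz
  have hI : Set.Ioo (0 : ℝ) 1 =ᵐ[volume] Set.Icc (0 : ℝ) 1 := Ioo_ae_eq_Icc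
  have hQ : (Set.Ioo (0 : ℝ) 1 ×ˢ Set.Ioo (0 : ℝ) 1 : Set (ℝ × ℝ)) =ᵐ[volume]
      (Set.Icc (0 : ℝ) 1 ×ˢ Set.Icc (0 : ℝ) 1 : Set (ℝ × ℝ)) := by
    rw [Measure.volume_eq_prod]
    exact Measure.set_prod_ae_eq hI hI
  have g1 : Gamma (b₂ - a₂) ≠ 0 := Gamma_ne_zero_of_re_pos (by simpa using hb₂)
  have g2 : Gamma (b₁ + b₃ - a₁ - a₃) ≠ 0 := Gamma_ne_zero_of_re_pos (by simp; linarith)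
  have g3 : Gamma (b₁ + b₂ + b₃ - a₁ - a₂ - a₃) ≠ 0 :=
    Gamma_ne_zero_of_re_pos (by simp; linarith)
  have hd := integrableOn_doubleIntegrand σ ha₁ ha₂ ha₃ hb₁ hb₂ hb₃ hz'
  have hF := hypergeometricFun_eq_integral_doubleIntegrand σ ha₁ ha₂ ha₃ hb₁ hb₂ hb₃ hz'
  -- Fubini makes the `y`-integral of the double integrand integrable in `s`; it is a nonzero
  -- multiple of the single integrand.
  have hs := (integrableOn_congr_fun (fun s hs => setIntegral_doubleIntegrand σ hb₁ hb₂ hb₃ z hs)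
    measurableSet_Ioo).1 (integrableOn_Ioo_integral hd)
  -- The boundary of the square is a null set, so the values of the integrands there are irrelevant.
  rw [← integrableOn_congr_set_ae hQ, ← setIntegral_congr_set hQ,
    ← integrableOn_congr_set_ae hI, ← setIntegral_congr_set hI]
  refine ⟨⟨hd, hF⟩, (integrable_const_mul_iff (IsUnit.mk0 _ ?_) _).1 hs, ?_⟩
  · exact div_ne_zero (mul_ne_zero g1 g2) g3
  · rw [hF, setIntegral_Ioo_prod hd, setIntegral_congr_fun measurableSet_Ioo
      (fun s hs => setIntegral_doubleIntegrand σ hb₁ hb₂ hb₃ z hs), integral_const_mul,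
      ← mul_assoc]
    congr 1
    field_simp
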